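/- An integer partition is a weakly decreasing sequence $\lambda=(\lambda_1,\lambda_2,\dots)$ of non-negative integers, all but finitely many of which are zero; its parts are its non-zero entries, and it is a partition of $n=\sum_i\lambda_i$. Put $I(\lambda)=\{(i,j)\in\mathbb{N}^2 : i\ge\lambda_{j+1}\}$, where $0\in\mathbb{N}$. The integral closure of a monoid ideal $I\subseteq\mathbb{N}^2$ is the set of all $a\in\mathbb{N}^2$ such that, for some integer $\ell\ge 1$, $\ell a$ is a sum of $\ell$ elements of $I$. The partition $\lambda$ is called concave if $I(\lambda)$ equals its integral closure. Let $r$ be a positive integer. Let $p(n,r)$ and $p_c(n,r)$ be the numbers of all partitions of $n$, respectively of all concave partitions of $n$, with at most $r$ parts. Let $$PC_r(x_1,\dots,x_r)=\sum_{\lambda} x_1^{\lambda_1}\cdots x_r^{\lambda_r},$$ the sum being over all concave partitions $\lambda$ with at most $r$ parts, and let $PC_r(t)=\sum_{n\ge0}p_c(n,r)t^n$. (i) There is a polynomial $Q_r(x_1,\dots,x_r)$ with integer coefficients such that, as formal power series, $$PC_r(x_1,\dots,x_r)=\frac{Q_r(x_1,\dots,x_r)}{\prod_{i=1}^r\bigl(1-\prod_{j=1}^i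 x_j^{1+i-j}\bigr)},$$ and its specialisation $Q_r(t)=Q_r(t,\dots,t)$ satisfies $$PC_r(t)=\frac{Q_r(t)}{\prod_{i=1}^r\bigl(1-t^{i(i+1)/2}\bigr)},\qquad Q_r(1)=1,\qquad \deg Q_r(t)<\frac{r^3}{6}+\frac{r^2}{2}+\frac{r}{3}.$$ (ii) Among the partitions with at most $r$ parts, the concave ones have asymptotic proportion $$\lim_{n\to\infty}\frac{p_c(n,r)}{p(n,r)}=\frac{r!}{\prod_{i=1}^r\frac{i(i+1)}{2}}.$$ -/

import Mathlib

open Filter Topology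
open scoped Nat

namespace ConcavePartition

/-- An integer partition: a weakly decreasing sequence of natural numbers, all but finitely many
of which are zero. Indices start at `0`, so `seq i` is the entry usually written `λ_{i+1}`. -/
@[ext]
structure IntPartition where
  seq : ℕ →₀ ℕ
  antitone : Antitone seq

namespace IntPartition

/-- The number `|λ|` that the partition partitions: the sum of its entries. -/
def weight (p : IntPartition) : ℕ := p.seq.sum fun _ a => a

/-- The number of parts, that is, of non-zero entries. -/
def numParts (p : IntPartition) : ℕ := p.seq.support.card

/-- The Ferrers diagram `{(i, j) | i < λ_{j+1}}`. -/
def ferrers (p : IntPartition) : Set (ℕ × ℕ) := {a | a.1 < p.seq a.2}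

/-- The monoid ideal `I(λ)` of `ℕ²`: the complement of the Ferrers diagram. -/
def ideal (p : IntPartition) : Set (ℕ × ℕ) := p.ferrersᶜ

/-- The exponent vector of the monomial `x^λ = x_1^{λ_1} ⋯ x_r^{λ_r}`
(for a partition with at most `r` parts). -/
noncomputable def exponent (r : ℕ) (p : IntPartition) : Fin r →₀ ℕ :=
  Finsupp.equivFunOnFinite.symm fun i => p.seq i

end IntPartition

/-- The integral closure of a monoid ideal `I` of `ℕ²`: all `a` such that, for some `ℓ ≥ 1`,
the multiple `ℓ a` is a sum of `ℓ` elements of `I`. -/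
def idealClosure (I : Set (ℕ × ℕ)) : Set (ℕ × ℕ) :=
  {a | ∃ l : ℕ, 0 < l ∧ ∃ f : Fin l → ℕ × ℕ, (∀ i, f i ∈ I) ∧ ∑ i, f i = l • a}

/-- A partition is concave if its monoid ideal is integrally closed. -/
def IntPartition.IsConcave (p : IntPartition) : Prop := idealClosure p.ideal = p.ideal

/-- The set of partitions of `n` with at most `r` parts. -/
def partitions (n r : ℕ) : Set IntPartition := {p | p.weight = n ∧ p.numParts ≤ r}

/-- The set of concave partitions of `n` with at most `r` parts. -/
def concavePartitions (n r : ℕ) : Set IntPartition := {p ∈ partitions n r | p.IsConcave}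

theorem finite_weight_eq (n : ℕ) : {p : IntPartition | p.weight = n}.Finite := by
  have hinj : Function.Injective IntPartition.seq := fun p q h => IntPartition.ext h
  refine Set.Finite.of_finite_image (f := IntPartition.seq) ?_ hinj.injOn
  refine ((Finset.range n).finsuppAntidiag n).finite_toSet.subset ?_
  rintro _ ⟨p, hp, rfl⟩
  have hp' : p.weight = n := hp
  have hsupp : p.seq.support ⊆ Finset.range n := by
    intro i hi
    have hi' : p.seq i ≠ 0 := Finsupp.mem_support_iff.mp hi
    have hsub : Finset.range (i + 1) ⊆ p.seq.support := by
      intro j hj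
      have hle := p.antitone (Nat.lt_succ_iff.mp (Finset.mem_range.mp hj))
      exact Finsupp.mem_support_iff.mpr (by omega)
    have h1 : i + 1 ≤ p.seq.support.card := by
      simpa using Finset.card_le_card hsub
    have h2 : p.seq.support.card ≤ p.weight := by
      rw [Finset.card_eq_sum_ones]
      exact Finset.sum_le_sum fun j hj => Nat.one_le_iff_ne_zero.mpr (Finsupp.mem_support_iff.mp hj)
    exact Finset.mem_range.mpr (by omega)
  rw [Finset.mem_coe, Finset.mem_finsuppAntidiag]
  refine ⟨?_, hsupp⟩
  refine Eq.trans ?_ hp'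
  exact (Finset.sum_subset hsupp fun i _ hi => Finsupp.notMem_support_iff.mp hi).symm

/-- The sets counted below are finite, so that `Set.ncard` is their number of elements. -/
theorem finite_partitions (n r : ℕ) : (partitions n r).Finite :=
  (finite_weight_eq n).subset fun _ h => h.1

theorem finite_concavePartitions (n r : ℕ) : (concavePartitions n r).Finite :=
  (finite_partitions n r).subset fun _ h => h.1

/-- `p(n, r)`: the number of partitions of `n` with at most `r` parts. -/
noncomputable def numPartitions (n r : ℕ) : ℕ := (partitions n r).ncard

/-- `p_c(n, r)`: the number of concave partitions of `n` with at most `r` parts. -/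
noncomputable def numConcave (n r : ℕ) : ℕ := (concavePartitions n r).ncard

/-- The partitions with at most `r` parts and a given exponent vector: there is at most one. -/
theorem subsingleton_exponent (r : ℕ) (m : Fin r →₀ ℕ) :
    {p : IntPartition | p.numParts ≤ r ∧ p.exponent r = m}.Subsingleton := by
  have key : ∀ p : IntPartition, p.numParts ≤ r → ∀ i, r ≤ i → p.seq i = 0 := by
    intro p hp i hi
    by_contra h
    have hsub : Finset.range (i + 1) ⊆ p.seq.support := by
      intro j hj
      have hle := p.antitone (Nat.lt_succ_iff.mp (Finset.mem_range.mp hj))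
      exact Finsupp.mem_support_iff.mpr (by omega)
    have h1 : i + 1 ≤ p.seq.support.card := by
      simpa using Finset.card_le_card hsub
    have h2 : p.seq.support.card ≤ r := hp
    omega
  rintro p ⟨hp, hpm⟩ q ⟨hq, hqm⟩
  refine IntPartition.ext (Finsupp.ext fun i => ?_)
  by_cases hi : i < r
  · have h := DFunLike.congr_fun (hpm.trans hqm.symm) ⟨i, hi⟩
    simpa [IntPartition.exponent] using h
  · rw [key p hp i (by omega), key q hq i (by omega)]

/-- The multi-generating function `PC_r(x_1, …, x_r) = ∑ x^λ`, summed over all concave partitions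
`λ` with at most `r` parts; the variable `X i` is `x_{i+1}`. -/
noncomputable def multiGenFun (r : ℕ) : MvPowerSeries (Fin r) ℤ := fun m =>
  (({p : IntPartition | p.IsConcave ∧ p.numParts ≤ r ∧ p.exponent r = m}.ncard : ℕ) : ℤ)

/-- The generating function `PC_r(t) = ∑ p_c(n, r) t^n`. -/
noncomputable def genFun (r : ℕ) : PowerSeries ℤ := PowerSeries.mk fun n => (numConcave n r : ℤ)

/-- The polynomial `∏_{i=1}^r (1 - ∏_{j=1}^i x_j^{1+i-j})`. -/
noncomputable def multiDenom (r : ℕ) : MvPolynomial (Fin r) ℤ :=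
  ∏ i : Fin r, (1 - ∏ j ∈ Finset.Iic i, MvPolynomial.X j ^ (1 + (i : ℕ) - (j : ℕ)))

/-- The polynomial `∏_{i=1}^r (1 - t^{i(i+1)/2})`. -/
noncomputable def denom (r : ℕ) : Polynomial ℤ :=
  ∏ i ∈ Finset.Icc 1 r, (1 - Polynomial.X ^ (i * (i + 1) / 2))

/-- The specialisation `Q(t, …, t)` of a polynomial `Q(x_1, …, x_r)`. -/
noncomputable def specialise {r : ℕ} (Q : MvPolynomial (Fin r) ℤ) : Polynomial ℤ :=
  MvPolynomial.aeval (fun _ : Fin r => (Polynomial.X : Polynomial ℤ)) Q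

end ConcavePartition

/-! A partition with at most `r` parts is concave exactly when, for all `i < m < k ≤ r`, the height
`λ_m - 1` lies strictly below the chord of `λ` over `(i, k)`: otherwise the chord gives a convex
combination putting `(λ_m - 1, m)` in the closure, and conversely a line separates that point from
the ideal (`isConcave_iff_hits`). Failures are recorded as violated intervals, with `k = r + 1`
encoding failures of monotonicity.

The denominator is `∏ (1 - x^ramp)`, so a coefficient of `PC_r` times it is an alternating sum, over
sets `U` of ramps, of the indicator that the exponent minus `∑_U ramp` has no violated interval.
After complementing `U`, one needs this to vanish for sequences `μ + ∑_U ramp` where `μ` has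
non-negative sum. Introduce a second set `V` and the signed double sum of the indicators that `V`
hits every violated interval of `μ + ∑_U ramp`. For fixed `U` the sum over `V` is zero, because some
point lies in no minimal violated interval (`sum_neg_of_cover`) and can be toggled in `V`. For fixed
`V ≠ ∅` the sum over `U` is zero, because a ramp with kink in `V` only affects intervals that `V`
already hits. What remains is `V = ∅`, the desired sum. Thus the numerator has degree below the
total weight `r(r+1)(r+2)/6` of the ramps, which is the stated bound.

For the asymptotics, second differences place the concave count between the numbers of solutions of
`∑ i(i+1)/2 · a_i = n` and of the same equation with `n` shifted by a constant
(`solutionCount_le_numConcave`, `numConcave_le_solutionCount`); partitions correspond to the weights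
`i`. Both counts follow from stars and bars by division with remainder. Comparing leading terms
yields the ratio and also `Q(1) = 1`. -/

namespace ConcavePartition

/-! ### Minimal violated intervals -/

/-- The interval `(i, k)` is violated by `μ` if it carries a failure of concavity (for `k ≤ r`) or
of monotonicity (for `k = r + 1`). -/
def IsViolated (r : ℕ) (μ : ℕ → ℤ) (i k : ℕ) : Prop :=
  ∃ m, i < m ∧ ((m < k ∧ k ≤ r ∧
      ((k : ℤ) - m) * μ i + ((m : ℤ) - i) * μ k ≤ ((k : ℤ) - i) * (μ m - 1)) ∨
    (k = r + 1 ∧ m ≤ r ∧ μ i < μ m))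

/-- The set `V` meets every violated interval; the index `j` stands for the point `j + 1`. -/
def Hits (r : ℕ) (V : Finset (Fin r)) (μ : ℕ → ℤ) : Prop :=
  ∀ i k, IsViolated r μ i k → ∃ j ∈ V, i ≤ (j : ℕ) ∧ (j : ℕ) + 1 < k

/-- An inclusion-minimal violated interval. -/
def IsMinViolated (r : ℕ) (μ : ℕ → ℤ) (i k : ℕ) : Prop :=
  IsViolated r μ i k ∧ ∀ i' k', i ≤ i' → k' ≤ k → IsViolated r μ i' k' → i' = i ∧ k' = k

/-- The sequence `j + 1, j, …, 1, 0, 0, …`. -/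
def ramp (j : ℕ) (x : ℕ) : ℤ := ((j + 1 - x : ℕ) : ℤ)

variable {r : ℕ} {μ : ℕ → ℤ}

theorem IsViolated.lt {i k : ℕ} (h : IsViolated r μ i k) : i + 1 < k ∧ k ≤ r + 1 ∧ i < r := by
  obtain ⟨m, hm, h | h⟩ := h <;> omega

theorem IsViolated.exists_min : ∀ {i k : ℕ}, IsViolated r μ i k →
    ∃ i' k', i ≤ i' ∧ k' ≤ k ∧ IsMinViolated r μ i' k' := by
  intro i k h
  induction hn : k - i using Nat.strong_induction_on generalizing i k with
  | _ n ih =>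
    by_cases hmin : IsMinViolated r μ i k
    · exact ⟨i, k, le_rfl, le_rfl, hmin⟩
    · simp only [IsMinViolated, h, true_and, not_forall] at hmin
      obtain ⟨i', k', hi, hk, hv, hne⟩ := hmin
      have h1 := h.lt
      have h2 := hv.lt
      obtain ⟨i'', k'', h3, h4, h5⟩ := ih (k' - i') (by omega) hv rfl
      exact ⟨i'', k'', by omega, by omega, h5⟩

/-- At the violating point `m`, the height `μ m - 1` is on or above the chord over `(i, k)`. For `x
≠ m`, minimality makes `(x, k)` or `(i, x)` unviolated at `m`, so the chord from `x` passes strictly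
above that height; hence `x` is above the original chord. -/
theorem IsMinViolated.above_chord {i k x : ℕ} (h : IsMinViolated r μ i k) (hk : k ≤ r)
    (hi : i < x) (hx : x < k) :
    ((k : ℤ) - x) * μ i + ((x : ℤ) - i) * μ k < ((k : ℤ) - i) * μ x := by
  obtain ⟨⟨m, him, h1 | h1⟩, hmin⟩ := h
  swap
  · omega
  obtain ⟨hmk, -, hm⟩ := h1
  have him' : (i : ℤ) < m := by exact_mod_cast him
  have hmk' : (m : ℤ) < k := by exact_mod_cast hmk
  have hi' : (i : ℤ) < x := by exact_mod_cast hi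
  have hx' : (x : ℤ) < k := by exact_mod_cast hx
  rcases lt_trichotomy x m with hxm | rfl | hxm
  · have hn : ¬ IsViolated r μ x k := fun hv => by
      have := (hmin x k hi.le le_rfl hv).1
      omega
    have hlt : ((k : ℤ) - x) * (μ m - 1) < ((k : ℤ) - m) * μ x + ((m : ℤ) - x) * μ k := by
      by_contra hc
      exact hn ⟨m, hxm, Or.inl ⟨hmk, hk, not_lt.mp hc⟩⟩
    have h2 := mul_lt_mul_of_pos_left hlt (show (0 : ℤ) < k - i by linarith)
    have h3 := mul_le_mul_of_nonneg_left hm (show (0 : ℤ) ≤ k - x by linarith)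
    refine lt_of_mul_lt_mul_left ?_ (show (0 : ℤ) ≤ k - m by linarith)
    linear_combination h2 + h3
  · linarith
  · have hn : ¬ IsViolated r μ i x := fun hv => by
      have := (hmin i x le_rfl hx.le hv).2
      omega
    have hlt : ((x : ℤ) - i) * (μ m - 1) < ((x : ℤ) - m) * μ i + ((m : ℤ) - i) * μ x := by
      by_contra hc
      exact hn ⟨m, him, Or.inl ⟨hxm, by omega, not_lt.mp hc⟩⟩
    have h2 := mul_lt_mul_of_pos_left hlt (show (0 : ℤ) < k - i by linarith)
    have h3 := mul_le_mul_of_nonneg_left hm (show (0 : ℤ) ≤ x - i by linarith)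
    refine lt_of_mul_lt_mul_left ?_ (show (0 : ℤ) ≤ m - i by linarith)
    linear_combination h2 + h3

theorem IsMinViolated.above_left {i x : ℕ} (h : IsMinViolated r μ i (r + 1))
    (hi : i < x) (hx : x ≤ r) : μ i < μ x := by
  obtain ⟨⟨m, him, h1 | h1⟩, hmin⟩ := h
  · omega
  obtain ⟨-, hmr, hm⟩ := h1
  rcases lt_trichotomy x m with hxm | rfl | hxm
  · by_contra hc
    have := (hmin x (r + 1) hi.le le_rfl ⟨m, hxm, Or.inr ⟨rfl, hmr, by omega⟩⟩).1
    omega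
  · exact hm
  · by_contra hc
    have him' : (i : ℤ) < m := by exact_mod_cast him
    have hxm' : (m : ℤ) < x := by exact_mod_cast hxm
    have := (hmin i x le_rfl (by omega) ⟨m, him, Or.inl ⟨hxm, hx, by
      have h1 : ((m : ℤ) - i) * μ x ≤ ((m : ℤ) - i) * μ i :=
        mul_le_mul_of_nonneg_left (not_lt.mp hc) (by linarith)
      have h2 : ((x : ℤ) - i) * μ i ≤ ((x : ℤ) - i) * (μ m - 1) :=
        mul_le_mul_of_nonneg_left (by omega) (by linarith)
      linarith⟩⟩).2
    omega

/-- Inside a minimal violated interval starting at a non-positive value, values that precede a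
non-positive value are non-positive. -/
theorem IsMinViolated.nonpos_of_neg {i k j y : ℕ} (h : IsMinViolated r μ i k) (hij : i < j)
    (hjy : j < y) (hyk : y < k) (hyr : y ≤ r) (hi : μ i ≤ 0) (hy : μ y ≤ 0) : μ j ≤ 0 := by
  by_contra hc
  have hij' : (i : ℤ) < j := by exact_mod_cast hij
  have hjy' : (j : ℤ) < y := by exact_mod_cast hjy
  -- If `μ j ≥ 1`, both end values are at most `0 ≤ μ j - 1`, so the shorter interval `(i, y)` would
  -- be violated at `j`.
  have := (h.2 i y le_rfl hyk.le ⟨j, hij, Or.inl ⟨hjy, hyr, by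
    have h1 : 0 ≤ ((y : ℤ) - i) * (μ j - 1) := mul_nonneg (by linarith) (by omega)
    have h2 : ((y : ℤ) - j) * μ i ≤ 0 := mul_nonpos_of_nonneg_of_nonpos (by linarith) hi
    have h3 : ((j : ℤ) - i) * μ y ≤ 0 := mul_nonpos_of_nonneg_of_nonpos (by linarith) hy
    linarith⟩⟩).2
  omega

/-- If the minimal violated intervals cover all points, then the sequence has negative sum. -/
theorem sum_neg_of_cover (hr : 0 < r) (hμ : ∀ x, r ≤ x → μ x = 0)
    (hcov : ∀ j < r, ∃ i k, IsMinViolated r μ i k ∧ i ≤ j ∧ j + 1 < k) :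
    ∑ x ∈ Finset.range r, μ x < 0 := by
  obtain ⟨a, k, ha, har, hk⟩ := hcov (r - 1) (by omega)
  obtain rfl : k = r + 1 := by have := ha.1.lt; omega
  have har' : a < r := by omega
  have haneg : μ a < 0 := by simpa [hμ r le_rfl] using ha.above_left har' le_rfl
  -- The interval covering the point `r` must end at `r + 1`, so its left end `a` carries a negative
  -- value; no entry may be positive enough to compensate.
  suffices h : ∀ j < r, μ j ≤ 0 from
    Finset.sum_neg' (fun j hj => h j (Finset.mem_range.mp hj)) ⟨a, Finset.mem_range.mpr har', haneg⟩
  intro j hj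
  by_contra hpos
  have hright : ∀ b, IsMinViolated r μ b (r + 1) → ∀ x, b < x → x < r → μ x ≤ 0 := by
    intro b hb x hbx hxr
    have hbneg : μ b < 0 := by simpa [hμ r le_rfl] using hb.above_left (hbx.trans hxr) le_rfl
    exact hb.nonpos_of_neg hbx hxr (by omega) le_rfl hbneg.le (hμ r le_rfl).le
  have hja : j < a := by
    by_contra hc
    rcases (not_lt.mp hc).lt_or_eq with hc | rfl
    · exact hpos (hright a ha j hc hj)
    · omega
  -- The minimal interval covering this minimum `y` starts at a value below `μ y`, hence to the left
  -- of `j`; it then contains `j` before a non-positive value, contradicting `μ j > 0`.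
  obtain ⟨y, hy, hmin⟩ := Finset.exists_min_image (Finset.Icc j r) μ ⟨j, by simp; omega⟩
  rw [Finset.mem_Icc] at hy
  have hyneg : μ y < 0 := (hmin a (by simp; omega)).trans_lt haneg
  have hyj : y ≠ j := by rintro rfl; omega
  have hyr : y ≠ r := by rintro rfl; rw [hμ _ le_rfl] at hyneg; omega
  obtain ⟨i, k, hik, h1, h2⟩ := hcov (y - 1) (by omega)
  have hiy : i < y := by omega
  have hyk : y < k := by omega
  rcases (hik.1.lt.2.1).lt_or_eq with hk | rfl
  · have hch := hik.above_chord (by omega) hiy hyk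
    have hiy' : (i : ℤ) < y := by exact_mod_cast hiy
    have hyk' : (y : ℤ) < k := by exact_mod_cast hyk
    have hmk := mul_le_mul_of_nonneg_left (hmin k (by simp; omega)) (show (0 : ℤ) ≤ y - i by linarith)
    have hlt : μ i < μ y := by
      refine lt_of_mul_lt_mul_left ?_ (show (0 : ℤ) ≤ k - y by linarith)
      linarith
    have hij : i < j := by
      by_contra hc
      have := hmin i (by simp; omega)
      omega
    exact hpos (hik.nonpos_of_neg hij (by omega) hyk (by omega) (by omega) hyneg.le)
  · have hlt := hik.above_left hiy (by omega)
    have hij : i < j := by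
      by_contra hc
      have := hmin i (by simp; omega)
      omega
    exact hpos (hright i hik j hij hj)

/-! ### Cancellation in the signed double sum -/

theorem sum_neg_one_pow_card_mul_eq_zero {ι : Type*} [Fintype ι] [DecidableEq ι] (f : Finset ι → ℤ)
    (j : ι) (h : ∀ V, j ∉ V → f (insert j V) = f V) :
    ∑ V : Finset ι, (-1) ^ V.card * f V = 0 := by
  rw [← Finset.powerset_univ, ← Finset.insert_erase (Finset.mem_univ j),
    Finset.sum_powerset_insert (Finset.notMem_erase _ _), ← Finset.sum_add_distrib]
  refine Finset.sum_eq_zero fun V hV => ?_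
  have hj : j ∉ V := fun hj => Finset.notMem_erase j _ (Finset.mem_powerset.mp hV hj)
  rw [h V hj, Finset.card_insert_of_notMem hj]
  ring

-- Hitting all violated intervals is the same as hitting the minimal ones. Since the sum is not
-- negative, these miss some point, and toggling it in `V` reverses the sign.
open scoped Classical in
theorem sum_hits_eq_zero (hr : 0 < r) (hμ : ∀ x, r ≤ x → μ x = 0)
    (hs : 0 ≤ ∑ x ∈ Finset.range r, μ x) :
    ∑ V : Finset (Fin r), (-1) ^ V.card * (if Hits r V μ then (1 : ℤ) else 0) = 0 := by
  by_contra hne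
  refine absurd (sum_neg_of_cover hr hμ fun j hj => ?_) (not_lt.mpr hs)
  by_contra hc
  refine hne (sum_neg_one_pow_card_mul_eq_zero _ ⟨j, hj⟩ fun V hV => if_congr ?_ rfl rfl)
  refine ⟨fun h i k hik => ?_, fun h i k hik => ?_⟩
  · obtain ⟨i', k', hi, hk, hm⟩ := hik.exists_min
    obtain ⟨l, hl, h1, h2⟩ := h i' k' hm.1
    rcases Finset.mem_insert.mp hl with rfl | hl
    · exact absurd ⟨i', k', hm, h1, h2⟩ hc
    · exact ⟨l, hl, by omega, by omega⟩
  · obtain ⟨l, hl, h⟩ := h i k hik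
    exact ⟨l, Finset.mem_insert_of_mem hl, h⟩

theorem ramp_of_le {j x : ℕ} (h : x ≤ j + 1) : ramp j x = j + 1 - x := by
  simp only [ramp]
  push_cast [Nat.cast_sub h]
  ring

theorem ramp_of_ge {j x : ℕ} (h : j + 1 ≤ x) : ramp j x = 0 := by
  simp [ramp, Nat.sub_eq_zero_of_le h]

/-- Adding a ramp whose kink lies outside an interval does not affect its violation. -/
theorem isViolated_add_ramp {i k j : ℕ} (hj : j < r) (h : ¬ (i ≤ j ∧ j + 1 < k)) :
    IsViolated r (μ + ramp j) i k ↔ IsViolated r μ i k := by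
  refine exists_congr fun m => and_congr_right fun him => ?_
  by_cases hij : j < i
  · simp only [Pi.add_apply, ramp_of_ge (show j + 1 ≤ i by omega),
      ramp_of_ge (show j + 1 ≤ m by omega), add_zero]
    refine or_congr (and_congr_right fun hmk => ?_) Iff.rfl
    rw [ramp_of_ge (show j + 1 ≤ k by omega), add_zero]
  -- The ramp is affine up to its kink, so it contributes equally to both sides; `k = r + 1` is
  -- excluded here.
  · have hk : k ≤ j + 1 := by omega
    refine or_congr (and_congr_right fun hmk => and_congr_right fun hkr => ?_) ?_
    · simp only [Pi.add_apply, ramp_of_le hk, ramp_of_le (show i ≤ j + 1 by omega),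
        ramp_of_le (show m ≤ j + 1 by omega)]
      rw [← sub_nonneg, ← sub_nonneg (b := _ + _ * μ k)]
      ring_nf
    · constructor <;> rintro ⟨h1, -⟩ <;> omega

theorem hits_add_ramp {V : Finset (Fin r)} {j : Fin r} (hj : j ∈ V) :
    Hits r V (μ + ramp j) ↔ Hits r V μ := by
  refine forall₂_congr fun i k => ?_
  by_cases h : i ≤ (j : ℕ) ∧ (j : ℕ) + 1 < k
  · exact iff_of_true (fun _ => ⟨j, hj, h⟩) fun _ => ⟨j, hj, h⟩
  · rw [isViolated_add_ramp j.2 h]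

-- Exchange of summation in the double sum over `U` and `V`: each inner sum over `V` vanishes, and
-- each inner sum over `U` vanishes unless `V = ∅`. Adding ramps preserves both the zero tail and
-- the sign of the sum.
open scoped Classical in
theorem sum_hits_empty_eq_zero (hr : 0 < r) (hμ : ∀ x, r ≤ x → μ x = 0)
    (hs : 0 ≤ ∑ x ∈ Finset.range r, μ x) :
    ∑ U : Finset (Fin r),
      (-1) ^ U.card * (if Hits r ∅ (μ + ∑ j ∈ U, ramp j) then (1 : ℤ) else 0) = 0 := by
  have h1 : ∀ U : Finset (Fin r), ∑ V : Finset (Fin r), (-1) ^ V.card *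
      (if Hits r V (μ + ∑ j ∈ U, ramp j) then (1 : ℤ) else 0) = 0 := by
    intro U
    refine sum_hits_eq_zero hr (fun x hx => ?_) ?_
    · rw [Pi.add_apply, hμ x hx, Finset.sum_apply, zero_add]
      exact Finset.sum_eq_zero fun j _ => ramp_of_ge (by omega)
    · simp only [Pi.add_apply, Finset.sum_add_distrib, Finset.sum_apply]
      exact add_nonneg hs (Finset.sum_nonneg fun _ _ => Finset.sum_nonneg fun _ _ =>
        Int.natCast_nonneg _)
  have h2 : ∑ V : Finset (Fin r), (-1) ^ V.card * ∑ U : Finset (Fin r), (-1) ^ U.card *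
      (if Hits r V (μ + ∑ j ∈ U, ramp j) then (1 : ℤ) else 0) = 0 := by
    simp_rw [Finset.mul_sum]
    rw [Finset.sum_comm]
    refine Finset.sum_eq_zero fun U _ => ?_
    rw [Finset.sum_congr rfl fun V _ => mul_left_comm _ _ _, ← Finset.mul_sum, h1, mul_zero]
  rw [Finset.sum_eq_single ∅] at h2
  · simpa using h2
  · intro V _ hV
    obtain ⟨j, hj⟩ := Finset.nonempty_iff_ne_empty.mpr hV
    rw [sum_neg_one_pow_card_mul_eq_zero _ j fun U hU => ?_, mul_zero]
    rw [Finset.sum_insert hU, add_comm (ramp _), ← add_assoc]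
    exact if_congr (hits_add_ramp hj) rfl rfl
  · simp

/-! ### Concavity as absence of violated intervals -/

theorem hits_empty_iff {μ : ℕ → ℤ} : Hits r ∅ μ ↔ ∀ i k, ¬ IsViolated r μ i k := by
  simp [Hits]

theorem IntPartition.numParts_le_iff {p : IntPartition} :
    p.numParts ≤ r ↔ ∀ i, r ≤ i → p.seq i = 0 := by
  constructor
  · intro hp i hi
    by_contra h
    have hsub : Finset.range (i + 1) ⊆ p.seq.support := by
      intro j hj
      have hle := p.antitone (Nat.lt_succ_iff.mp (Finset.mem_range.mp hj))
      exact Finsupp.mem_support_iff.mpr (by omega)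
    have h1 : i + 1 ≤ p.seq.support.card := by
      simpa using Finset.card_le_card hsub
    have h2 : p.seq.support.card ≤ r := hp
    omega
  · intro h
    have hsub : p.seq.support ⊆ Finset.range r := by
      intro i hi
      by_contra hc
      exact Finsupp.mem_support_iff.mp hi (h i (by simpa using hc))
    simpa [IntPartition.numParts] using Finset.card_le_card hsub

theorem IntPartition.weight_eq_sum_range {p : IntPartition} (hp : p.numParts ≤ r) :
    p.weight = ∑ x ∈ Finset.range r, p.seq x := by
  refine Finset.sum_subset (fun i hi => ?_) fun i _ hi => Finsupp.notMem_support_iff.mp hi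
  by_contra hc
  exact Finsupp.mem_support_iff.mp hi (numParts_le_iff.mp hp i (by simpa using hc))

theorem exists_intPartition {f : ℕ → ℕ} (hf : Antitone f) (h0 : ∀ x, r ≤ x → f x = 0) :
    ∃ p : IntPartition, p.numParts ≤ r ∧ ∀ x, p.seq x = f x := by
  refine ⟨⟨Finsupp.onFinset (Finset.range r) f fun x hx => ?_, hf⟩, ?_, fun x => rfl⟩
  · by_contra hc
    exact hx (h0 x (by simpa using hc))
  · exact IntPartition.numParts_le_iff.mpr h0

theorem mem_idealClosure_of_isViolated {p : IntPartition} {i m k : ℕ} (him : i < m) (hmk : m < k)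
    (h : (k - m) * p.seq i + (m - i) * p.seq k ≤ (k - i) * (p.seq m - 1)) :
    (p.seq m - 1, m) ∈ idealClosure p.ideal := by
  obtain ⟨a, rfl⟩ := Nat.exists_eq_add_of_lt him
  obtain ⟨b, rfl⟩ := Nat.exists_eq_add_of_lt hmk
  have e1 : i + a + 1 + b + 1 - (i + a + 1) = b + 1 := by omega
  have e2 : i + a + 1 - i = a + 1 := by omega
  have e3 : i + a + 1 + b + 1 - i = b + (a + 1) + 1 := by omega
  rw [e1, e2, e3] at h
  obtain ⟨d, hd⟩ := Nat.exists_eq_add_of_le h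
  -- With `ℓ = k - i`, take `k - m` points in row `i` and `m - i` points in row `k`; the slack `d`
  -- of the inequality is absorbed by one of the former.
  refine ⟨b + (a + 1) + 1, by omega, Fin.cons (p.seq i + d, i) (Fin.append
    (fun _ : Fin b => (p.seq i, i)) fun _ : Fin (a + 1) => (p.seq (i + a + 1 + b + 1),
      i + a + 1 + b + 1)), ?_, ?_⟩
  · intro s
    refine Fin.cases ?_ (fun s => ?_) s
    · simp [IntPartition.ideal, IntPartition.ferrers]
    · refine Fin.addCases (fun s => ?_) (fun s => ?_) s <;>
        simp [IntPartition.ideal, IntPartition.ferrers]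
  · rw [Fin.sum_univ_succ, Fin.sum_univ_add]
    simp only [Fin.cons_zero, Fin.cons_succ, Fin.append_left, Fin.append_right, Finset.sum_const,
      Finset.card_univ, Fintype.card_fin, Prod.smul_mk, smul_eq_mul, Prod.mk_add_mk, Prod.mk.injEq]
    constructor
    · rw [hd]
      ring
    · ring

theorem subset_idealClosure (I : Set (ℕ × ℕ)) : I ⊆ idealClosure I :=
  fun a ha => ⟨1, one_pos, fun _ => a, fun _ => ha, by simp⟩

theorem idealClosure_subset_of_hits {p : IntPartition} (hp : p.numParts ≤ r)
    (h : Hits r ∅ fun x => (p.seq x : ℤ)) : idealClosure p.ideal ⊆ p.ideal := by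
  rintro ⟨x, m⟩ ⟨l, hl, f, hf, hsum⟩
  by_contra hx
  have hx' : x + 1 ≤ p.seq m := by simpa [IntPartition.ideal, IntPartition.ferrers] using hx
  have h0 := IntPartition.numParts_le_iff.mp hp
  have hmr : m < r := by
    by_contra hc
    have := h0 m (by omega)
    omega
  -- The slope `s` separates the difference quotients to the left and right of `m`. The line of
  -- slope `s` through height `λ_m - 1` at `m` then runs strictly below `λ`, and averaging over the
  -- `ℓ` ideal elements forces `x > λ_m - 1`.
  obtain ⟨s, hlo, hhi⟩ := Order.exists_between_finsets
    ((Finset.range m).image fun i => (((p.seq m : ℚ) - 1 - p.seq i) / ((m : ℚ) - i)))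
    ((Finset.Ioc m r).image fun k => (((p.seq k : ℚ) - (p.seq m - 1)) / ((k : ℚ) - m))) (by
      simp only [Finset.mem_image, Finset.mem_range, Finset.mem_Ioc]
      rintro _ ⟨i, hi, rfl⟩ _ ⟨k, ⟨hmk, hkr⟩, rfl⟩
      have hi' : (i : ℚ) < m := by exact_mod_cast hi
      have hk' : (m : ℚ) < k := by exact_mod_cast hmk
      rw [div_lt_div_iff₀ (by linarith) (by linarith)]
      have hn : ((k : ℤ) - i) * ((p.seq m : ℤ) - 1)
          < ((k : ℤ) - m) * p.seq i + ((m : ℤ) - i) * p.seq k := by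
        by_contra hc
        exact hits_empty_iff.mp h i k ⟨m, hi, Or.inl ⟨hmk, hkr, not_lt.mp hc⟩⟩
      have hn' : ((k : ℚ) - i) * ((p.seq m : ℚ) - 1)
          < ((k : ℚ) - m) * p.seq i + ((m : ℚ) - i) * p.seq k := by exact_mod_cast hn
      linarith)
  have hpm : (1 : ℚ) ≤ p.seq m := by exact_mod_cast (show 1 ≤ p.seq m by omega)
  have habove : ∀ y : ℕ, (p.seq m : ℚ) - 1 + s * (y - m) < p.seq y := by
    intro y
    have hright : ∀ k, m < k → k ≤ r → (p.seq m : ℚ) - 1 + s * (k - m) < p.seq k := by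
      intro k hmk hkr
      have h1 := hhi _ (Finset.mem_image_of_mem _ (Finset.mem_Ioc.mpr ⟨hmk, hkr⟩))
      have hk' : (m : ℚ) < k := by exact_mod_cast hmk
      rw [lt_div_iff₀ (by linarith)] at h1
      linarith
    rcases lt_trichotomy y m with hy | rfl | hy
    · have h1 := hlo _ (Finset.mem_image_of_mem _ (Finset.mem_range.mpr hy))
      have hy' : (y : ℚ) < m := by exact_mod_cast hy
      rw [div_lt_iff₀ (by linarith)] at h1
      linarith
    · linarith
    · rcases le_or_gt y r with hyr | hyr
      · exact hright y hy hyr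
      -- Beyond `r`: the line is non-negative at `m` and negative at `r`, so it descends and stays
      -- below zero.
      · have h1 := hright r hmr le_rfl
        rw [h0 r le_rfl] at h1
        rw [h0 y hyr.le]
        have hr' : (m : ℚ) < r := by exact_mod_cast hmr
        have hy' : (r : ℚ) < y := by exact_mod_cast hyr
        have hs : s < 0 := by
          by_contra hc
          have := mul_nonneg (not_lt.mp hc) (sub_nonneg.mpr hr'.le)
          push_cast at h1
          linarith
        have := mul_lt_mul_of_neg_left hy' hs
        push_cast at h1 ⊢
        linarith
  have hfst : ∑ t, (f t).1 = l * x := by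
    have := congrArg Prod.fst hsum
    simpa [Prod.fst_sum] using this
  have hsnd : ∑ t, (f t).2 = l * m := by
    have := congrArg Prod.snd hsum
    simpa [Prod.snd_sum] using this
  have hlt : ∑ t : Fin l, ((p.seq m : ℚ) - 1 + s * ((f t).2 - m)) < ∑ t : Fin l, ((f t).1 : ℚ) := by
    refine Finset.sum_lt_sum_of_nonempty ⟨⟨0, hl⟩, Finset.mem_univ _⟩ fun t _ => ?_
    have h1 : p.seq (f t).2 ≤ (f t).1 := by
      simpa [IntPartition.ideal, IntPartition.ferrers] using hf t
    exact (habove _).trans_le (by exact_mod_cast h1)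
  have hfst' : ∑ t, ((f t).1 : ℚ) = l * x := by exact_mod_cast hfst
  have hsnd' : ∑ t, ((f t).2 : ℚ) = l * m := by exact_mod_cast hsnd
  simp only [Finset.sum_add_distrib, ← Finset.mul_sum, Finset.sum_sub_distrib, hfst', hsnd',
    Finset.sum_const, Finset.card_univ, Fintype.card_fin, nsmul_eq_mul] at hlt
  have hl' : (0 : ℚ) < l := by exact_mod_cast hl
  have hlt' : (p.seq m : ℚ) - 1 < x := by
    refine lt_of_mul_lt_mul_left ?_ hl'.le
    linear_combination hlt
  have : (x : ℚ) + 1 ≤ p.seq m := by exact_mod_cast hx'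
  linarith

theorem isConcave_iff_hits {p : IntPartition} (hp : p.numParts ≤ r) :
    p.IsConcave ↔ Hits r ∅ fun x => (p.seq x : ℤ) := by
  constructor
  · rw [hits_empty_iff]
    rintro h i k ⟨m, him, ⟨hmk, hkr, hm⟩ | ⟨-, -, hm⟩⟩
    · have him' : (i : ℤ) < m := by exact_mod_cast him
      have hmk' : (m : ℤ) < k := by exact_mod_cast hmk
      -- Needed so that the truncated `p.seq m - 1` is the integer difference; `λ_m = 0` can never
      -- violate.
      have hpm : 1 ≤ p.seq m := by
        by_contra hc
        have h1 : 0 ≤ ((k : ℤ) - m) * (p.seq i : ℤ) := mul_nonneg (by linarith) (by positivity)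
        have h2 : 0 ≤ ((m : ℤ) - i) * (p.seq k : ℤ) := mul_nonneg (by linarith) (by positivity)
        have h3 : p.seq m = 0 := by omega
        simp only [h3, Nat.cast_zero] at hm
        linarith
      have hmem : (p.seq m - 1, m) ∈ p.ideal := by
        rw [← h]
        refine mem_idealClosure_of_isViolated him hmk ?_
        zify [hmk.le, him.le, (him.trans hmk).le, hpm]
        exact hm
      have hnot : ¬ p.seq m - 1 < p.seq m := hmem
      omega
    · exact absurd (p.antitone him.le) (not_le.mpr (Int.ofNat_lt.mp hm))
  · intro h
    exact (idealClosure_subset_of_hits hp h).antisymm (subset_idealClosure _)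

theorem Hits.le_of_lt {μ : ℕ → ℤ} (h : Hits r ∅ μ) {i m : ℕ} (him : i < m) (hm : m ≤ r) :
    μ m ≤ μ i := by
  by_contra hc
  exact hits_empty_iff.mp h i (r + 1) ⟨m, him, Or.inr ⟨rfl, hm, not_le.mp hc⟩⟩

theorem Hits.nonneg {μ : ℕ → ℤ} (hμ : ∀ x, r ≤ x → μ x = 0) (h : Hits r ∅ μ) (x : ℕ) :
    0 ≤ μ x := by
  rcases lt_or_ge x r with hx | hx
  · exact (hμ r le_rfl).symm.le.trans (h.le_of_lt hx le_rfl)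
  · exact (hμ x hx).symm.le

/-- Integer sequences without violated intervals are concave partitions. -/
theorem exists_concave_of_hits {μ : ℕ → ℤ} (hμ : ∀ x, r ≤ x → μ x = 0) (h : Hits r ∅ μ) :
    ∃ p : IntPartition, p.IsConcave ∧ p.numParts ≤ r ∧ ∀ x, (p.seq x : ℤ) = μ x := by
  obtain ⟨p, hp, hseq⟩ := exists_intPartition (r := r) (f := fun x => (μ x).toNat)
    (fun x y hxy => Int.toNat_le_toNat (by
      rcases le_or_gt y r with hy | hy
      · rcases hxy.eq_or_lt with rfl | hlt
        · exact le_rfl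
        · exact h.le_of_lt hlt hy
      · exact (hμ y hy.le).le.trans (h.nonneg hμ x))) fun x hx => by simp [hμ x hx]
  have hseq' : ∀ x, (p.seq x : ℤ) = μ x := fun x => by
    rw [hseq, Int.toNat_of_nonneg (h.nonneg hμ x)]
  exact ⟨p, (isConcave_iff_hits hp).mpr (by simpa only [hseq'] using h), hp, hseq'⟩

/-! ### Coefficients of the multivariate numerator -/

/-- An exponent vector as an integer sequence, extended by zeros. -/
def extend (m : Fin r →₀ ℕ) (x : ℕ) : ℤ := if h : x < r then (m ⟨x, h⟩ : ℤ) else 0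

theorem extend_of_ge (m : Fin r →₀ ℕ) {x : ℕ} (h : r ≤ x) : extend m x = 0 :=
  dif_neg (not_lt.mpr h)

@[simp]
theorem extend_fin (m : Fin r →₀ ℕ) (i : Fin r) : extend m i = m i := by
  simp [extend]

theorem sum_extend (m : Fin r →₀ ℕ) : ∑ x ∈ Finset.range r, extend m x = m.degree := by
  rw [Finset.sum_range, Finsupp.degree_eq_sum]
  simp

theorem extend_exponent {p : IntPartition} (hp : p.numParts ≤ r) (x : ℕ) :
    extend (p.exponent r) x = p.seq x := by
  rcases lt_or_ge x r with hx | hx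
  · simp [extend, hx, IntPartition.exponent]
  · rw [extend_of_ge _ hx, IntPartition.numParts_le_iff.mp hp x hx, Nat.cast_zero]

theorem degree_exponent {p : IntPartition} (hp : p.numParts ≤ r) :
    (p.exponent r).degree = p.weight := by
  rw [IntPartition.weight_eq_sum_range hp, Finset.sum_range, Finsupp.degree_eq_sum]
  simp [IntPartition.exponent]

theorem exists_concave_iff (m : Fin r →₀ ℕ) :
    (∃ p : IntPartition, p.IsConcave ∧ p.numParts ≤ r ∧ p.exponent r = m) ↔
      Hits r ∅ (extend m) := by
  constructor
  · rintro ⟨p, hc, hp, rfl⟩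
    rw [funext (extend_exponent hp)]
    exact (isConcave_iff_hits hp).mp hc
  · intro h
    obtain ⟨p, hc, hp, hseq⟩ := exists_concave_of_hits (fun x hx => extend_of_ge m hx) h
    refine ⟨p, hc, hp, Finsupp.ext fun i => ?_⟩
    have := hseq i
    rw [extend_fin] at this
    simpa [IntPartition.exponent] using this

open scoped Classical in
theorem coeff_multiGenFun (m : Fin r →₀ ℕ) :
    MvPowerSeries.coeff m (multiGenFun r) = if Hits r ∅ (extend m) then 1 else 0 := by
  change (({p : IntPartition | p.IsConcave ∧ p.numParts ≤ r ∧ p.exponent r = m}.ncard : ℕ) : ℤ) = _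
  have hsub : {p : IntPartition | p.IsConcave ∧ p.numParts ≤ r ∧ p.exponent r = m}.Subsingleton :=
    (subsingleton_exponent r m).anti fun p hp => hp.2
  split_ifs with h
  · obtain ⟨p, hp⟩ := (exists_concave_iff m).mpr h
    rw [hsub.eq_singleton_of_mem hp, Set.ncard_singleton, Nat.cast_one]
  · have hempty : {p : IntPartition | p.IsConcave ∧ p.numParts ≤ r ∧ p.exponent r = m} = ∅ :=
      Set.eq_empty_of_forall_notMem fun p hp => h ((exists_concave_iff m).mp ⟨p, hp⟩)
    rw [hempty, Set.ncard_empty, Nat.cast_zero]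

/-- The exponent vector `(i + 1, i, …, 1, 0, …, 0)`. -/
noncomputable def rampExponent (i : Fin r) : Fin r →₀ ℕ :=
  Finsupp.equivFunOnFinite.symm fun j => i + 1 - j

theorem rampExponent_apply (i j : Fin r) : rampExponent i j = (i : ℕ) + 1 - j := rfl

theorem prod_X_pow_eq_monomial (i : Fin r) :
    (∏ j ∈ Finset.Iic i, MvPolynomial.X j ^ (1 + (i : ℕ) - (j : ℕ)) : MvPolynomial (Fin r) ℤ) =
      MvPolynomial.monomial (rampExponent i) 1 := by
  rw [MvPolynomial.monomial_eq, Finsupp.prod_fintype _ _ (by simp), MvPolynomial.C_1, one_mul]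
  refine Finset.prod_subset_one_on_sdiff (Finset.subset_univ _) (fun j hj => ?_) fun j hj => ?_
  · have hij : i < j := by simpa using hj
    rw [rampExponent_apply, Nat.sub_eq_zero_of_le (by exact hij), pow_zero]
  · rw [rampExponent_apply, add_comm]

theorem coe_multiDenom : (multiDenom r : MvPowerSeries (Fin r) ℤ) =
    ∑ U : Finset (Fin r), (-1) ^ U.card *
      MvPowerSeries.monomial (∑ i ∈ U, rampExponent i) (1 : ℤ) := by
  have h : multiDenom r = ∑ U : Finset (Fin r), (-1) ^ U.card *
      MvPolynomial.monomial (∑ i ∈ U, rampExponent i) (1 : ℤ) := by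
    rw [multiDenom, Finset.prod_congr rfl fun i _ => by rw [prod_X_pow_eq_monomial],
      Finset.prod_sub, Finset.powerset_univ]
    refine Finset.sum_congr rfl fun U _ => ?_
    rw [Finset.prod_const_one, mul_one, MvPolynomial.monomial_sum_one]
  rw [h, ← MvPolynomial.coeToMvPowerSeries.ringHom_apply, map_sum]
  refine Finset.sum_congr rfl fun U _ => ?_
  rw [map_mul, map_pow, map_neg, map_one, MvPolynomial.coeToMvPowerSeries.ringHom_apply,
    MvPolynomial.coe_monomial]

theorem extend_sub_sum {m : Fin r →₀ ℕ} {U : Finset (Fin r)} (h : ∑ i ∈ U, rampExponent i ≤ m) :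
    extend (m - ∑ i ∈ U, rampExponent i) = extend m - ∑ i ∈ U, ramp i := by
  funext x
  rw [Pi.sub_apply, Finset.sum_apply]
  rcases lt_or_ge x r with hx | hx
  · have hle := h ⟨x, hx⟩
    simp only [extend, hx, dif_pos, Finsupp.tsub_apply]
    rw [Nat.cast_sub hle, Finsupp.finsetSum_apply]
    push_cast
    rfl
  · rw [extend_of_ge _ hx, extend_of_ge _ hx, Finset.sum_eq_zero fun i _ => ramp_of_ge (by omega),
      sub_zero]

open scoped Classical in
theorem coeff_multiGenFun_mul (m : Fin r →₀ ℕ) :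
    MvPowerSeries.coeff m (multiGenFun r * (multiDenom r : MvPowerSeries (Fin r) ℤ)) =
      ∑ U : Finset (Fin r), (-1) ^ U.card *
        (if Hits r ∅ (extend m - ∑ i ∈ U, ramp i) then (1 : ℤ) else 0) := by
  rw [coe_multiDenom, Finset.mul_sum, map_sum]
  refine Finset.sum_congr rfl fun U _ => ?_
  have hC : (-1 : MvPowerSeries (Fin r) ℤ) ^ U.card = MvPowerSeries.C ((-1) ^ U.card) := by simp
  rw [mul_left_comm, hC, MvPowerSeries.coeff_C_mul, MvPowerSeries.coeff_mul_monomial, mul_one]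
  congr 1
  split_ifs with h1 h2 h2
  · rw [coeff_multiGenFun, if_pos (by rwa [extend_sub_sum h1])]
  · rw [coeff_multiGenFun, if_neg (by rwa [extend_sub_sum h1])]
  -- When the monomial does not divide `x^m` the coefficient is zero; the indicator agrees, since a
  -- sequence without violated intervals and with zero tail has no negative entry.
  · refine absurd (fun j => ?_) h1
    have h3 := h2.nonneg (fun x hx => by
      rw [Pi.sub_apply, extend_of_ge _ hx, Finset.sum_apply,
        Finset.sum_eq_zero fun i _ => ramp_of_ge (by omega), sub_zero]) j
    rw [Pi.sub_apply, extend_fin, Finset.sum_apply, sub_nonneg] at h3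
    rw [Finsupp.finsetSum_apply]
    have h4 : ((∑ i ∈ U, rampExponent i j : ℕ) : ℤ) ≤ m j := by
      rw [Nat.cast_sum]
      exact h3
    exact_mod_cast h4
  · rfl

theorem sum_ramp {j : ℕ} (hj : j < r) :
    ∑ x ∈ Finset.range r, (j + 1 - x) = (j + 1) * (j + 2) / 2 := by
  obtain ⟨d, rfl⟩ := Nat.exists_eq_add_of_lt hj
  rw [show j + d + 1 = (j + 1) + d by ring, Finset.sum_range_add,
    Finset.sum_eq_zero (s := Finset.range d) fun x _ => by omega, add_zero,
    ← Finset.sum_range_reflect]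
  have h := Finset.sum_range_id_mul_two (j + 2)
  rw [Finset.sum_range_succ'] at h
  simp only [add_zero] at h
  rw [Finset.sum_congr rfl (g := fun x => x + 1) fun x hx => by
    have := Finset.mem_range.mp hx
    omega]
  refine (Nat.div_eq_of_eq_mul_left two_pos ?_).symm
  rw [h, show j + 2 - 1 = j + 1 by omega]
  ring

-- Base the alternating sum at `m` minus all ramps: removing `U` from `m` amounts to adding the
-- complementary ramps back. The degree hypothesis says that this base sequence has non-negative
-- sum.
open scoped Classical in
theorem coeff_multiGenFun_mul_eq_zero (hr : 0 < r) (m : Fin r →₀ ℕ)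
    (hm : ∑ j ∈ Finset.range r, (j + 1) * (j + 2) / 2 ≤ m.degree) :
    MvPowerSeries.coeff m (multiGenFun r * (multiDenom r : MvPowerSeries (Fin r) ℤ)) = 0 := by
  have h0 := sum_hits_empty_eq_zero (μ := extend m - ∑ i : Fin r, ramp i) hr (fun x hx => by
      rw [Pi.sub_apply, extend_of_ge _ hx, Finset.sum_apply,
        Finset.sum_eq_zero fun i _ => ramp_of_ge (by omega), sub_zero]) (by
      simp only [Pi.sub_apply, Finset.sum_apply, Finset.sum_sub_distrib, sum_extend]
      rw [Finset.sum_comm, sub_nonneg, ← Fin.sum_univ_eq_sum_range] at *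
      have h1 : ∀ i : Fin r, ∑ x ∈ Finset.range r, ramp i x =
          ((((i : ℕ) + 1) * (i + 2) / 2 : ℕ) : ℤ) := fun i => by
        rw [← sum_ramp i.2, Nat.cast_sum]
        rfl
      rw [Finset.sum_congr rfl fun i _ => h1 i]
      exact_mod_cast hm)
  rw [coeff_multiGenFun_mul]
  have hcompl : ∀ U : Finset (Fin r), extend m - ∑ i ∈ U, ramp i =
      extend m - ∑ i : Fin r, ramp i + ∑ i ∈ Uᶜ, ramp i := fun U => by
    rw [← Finset.sum_add_sum_compl U]
    abel
  have hcard : ∀ U : Finset (Fin r), (-1 : ℤ) ^ U.card = (-1) ^ r * (-1) ^ Uᶜ.card := fun U => by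
    rw [Finset.card_compl, Fintype.card_fin, ← pow_add]
    have hle : U.card ≤ r := by simpa using U.card_le_univ
    rw [show r + (r - U.card) = U.card + 2 * (r - U.card) by omega, pow_add, pow_mul]
    simp
  rw [Finset.sum_congr rfl fun U _ => by rw [hcompl U, hcard U, mul_assoc], ← Finset.mul_sum]
  refine mul_eq_zero_of_right _ (Eq.trans ?_ h0)
  exact Fintype.sum_equiv (compl_involutive (α := Finset (Fin r))).toPerm _ _ fun U => rfl

/-! ### Specialisation to one variable -/

theorem hasSubst_const_X (r : ℕ) :
    MvPowerSeries.HasSubst fun _ : Fin r => (PowerSeries.X : PowerSeries ℤ) :=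
  MvPowerSeries.hasSubst_of_constantCoeff_zero fun _ => PowerSeries.constantCoeff_X

theorem numConcave_eq_ncard (n : ℕ) :
    numConcave n r = {m : Fin r →₀ ℕ | Hits r ∅ (extend m) ∧ m.degree = n}.ncard := by
  refine Set.ncard_congr (fun p _ => p.exponent r) ?_ ?_ ?_
  · rintro p ⟨⟨hw, hp⟩, hc⟩
    exact ⟨(exists_concave_iff _).mp ⟨p, hc, hp, rfl⟩, (degree_exponent hp).trans hw⟩
  · rintro p q ⟨⟨-, hp⟩, -⟩ ⟨⟨-, hq⟩, -⟩ h
    exact subsingleton_exponent r _ ⟨hp, h⟩ ⟨hq, rfl⟩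
  · rintro m ⟨hm, hd⟩
    obtain ⟨p, hc, hp, rfl⟩ := (exists_concave_iff m).mpr hm
    exact ⟨p, ⟨⟨(degree_exponent hp).symm.trans hd, hp⟩, hc⟩, rfl⟩

theorem subst_multiGenFun (r : ℕ) :
    MvPowerSeries.subst (fun _ : Fin r => (PowerSeries.X : PowerSeries ℤ)) (multiGenFun r) =
      genFun r := by
  classical
  refine PowerSeries.ext fun n => ?_
  rw [genFun, PowerSeries.coeff_mk, numConcave_eq_ncard, PowerSeries.coeff,
    MvPowerSeries.coeff_subst (hasSubst_const_X r)]
  have h : ∀ d : Fin r →₀ ℕ, (MvPowerSeries.coeff d (multiGenFun r) •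
      MvPowerSeries.coeff (Finsupp.single () n)
        (d.prod fun _ e => (PowerSeries.X : PowerSeries ℤ) ^ e)) =
      ∑ᶠ _ : d ∈ {m : Fin r →₀ ℕ | Hits r ∅ (extend m) ∧ m.degree = n}, (1 : ℤ) := fun d => by
    have h1 : (d.prod fun _ e => (PowerSeries.X : PowerSeries ℤ) ^ e) = PowerSeries.X ^ d.degree := by
      rw [Finsupp.prod, Finset.prod_pow_eq_pow_sum]
      rfl
    have h2 : MvPowerSeries.coeff (Finsupp.single () n) ((PowerSeries.X : PowerSeries ℤ) ^ d.degree)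
        = if n = d.degree then 1 else 0 := PowerSeries.coeff_X_pow n d.degree
    rw [h1, h2, coeff_multiGenFun, smul_eq_mul, finsum_eq_if]
    by_cases h3 : Hits r ∅ (extend d) <;> by_cases h4 : n = d.degree <;> simp [h3, h4, eq_comm]
  rw [finsum_congr h]
  have hfin : {m : Fin r →₀ ℕ | Hits r ∅ (extend m) ∧ m.degree = n}.Finite :=
    (Finsupp.finite_of_degree_le n).subset fun m hm => hm.2.le
  rw [finsum_mem_eq_finite_toFinset_sum _ hfin, Set.ncard_eq_toFinset_card _ hfin]
  simp

theorem specialise_multiDenom (r : ℕ) : specialise (multiDenom r) = denom r := by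
  rw [specialise, multiDenom, map_prod, denom,
    show Finset.Icc 1 r = Finset.Ico 1 (r + 1) by ext; simp,
    Finset.prod_Ico_eq_prod_range, Nat.add_sub_cancel, Finset.prod_range]
  refine Finset.prod_congr rfl fun i _ => ?_
  rw [prod_X_pow_eq_monomial, map_sub, map_one, MvPolynomial.aeval_monomial, map_one, one_mul,
    Finsupp.prod_fintype _ _ (by simp), Finset.prod_pow_eq_pow_sum]
  simp only [rampExponent_apply]
  rw [Fin.sum_univ_eq_sum_range (fun x => (i : ℕ) + 1 - x), sum_ramp i.2]
  congr 3
  ring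

theorem coe_specialise (Q : MvPolynomial (Fin r) ℤ) :
    (specialise Q : PowerSeries ℤ) =
      MvPowerSeries.subst (fun _ : Fin r => (PowerSeries.X : PowerSeries ℤ))
        (Q : MvPowerSeries (Fin r) ℤ) := by
  rw [MvPowerSeries.subst_coe, specialise]
  have := MvPolynomial.comp_aeval_apply (fun _ : Fin r => (Polynomial.X : Polynomial ℤ))
    (Polynomial.coeToPowerSeries.algHom ℤ) Q
  simpa using this

theorem natDegree_specialise_le (Q : MvPolynomial (Fin r) ℤ) :
    (specialise Q).natDegree ≤ Q.totalDegree := by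
  rw [specialise, MvPolynomial.aeval_def, MvPolynomial.eval₂_eq]
  refine Polynomial.natDegree_sum_le_of_forall_le _ _ fun d hd => ?_
  refine (Polynomial.natDegree_mul_le).trans ?_
  rw [Finset.prod_pow_eq_pow_sum, Polynomial.natDegree_X_pow]
  refine (Nat.add_le_add_right (Polynomial.natDegree_C _).le _).trans ?_
  rw [zero_add]
  exact MvPolynomial.le_totalDegree hd

/-- The product has no terms of total degree at least `W`, so it equals its own truncation; setting
all variables to `t` cannot raise the degree. -/
theorem exists_numerator (hr : 0 < r) :
    ∃ Q : MvPolynomial (Fin r) ℤ,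
      multiGenFun r * (multiDenom r : MvPowerSeries (Fin r) ℤ) = (Q : MvPowerSeries (Fin r) ℤ) ∧
      genFun r * (denom r : PowerSeries ℤ) = (specialise Q : PowerSeries ℤ) ∧
      (specialise Q).natDegree < ∑ j ∈ Finset.range r, (j + 1) * (j + 2) / 2 := by
  set W := ∑ j ∈ Finset.range r, (j + 1) * (j + 2) / 2 with hW
  have hW0 : W ≠ 0 := by
    have h := Finset.single_le_sum (f := fun j => (j + 1) * (j + 2) / 2)
      (fun _ _ => Nat.zero_le _) (Finset.mem_range.mpr hr)
    simp only [zero_add] at h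
    omega
  set F := multiGenFun r * (multiDenom r : MvPowerSeries (Fin r) ℤ) with hF
  have hQ : F = (MvPowerSeries.truncTotal W F : MvPolynomial (Fin r) ℤ) := by
    ext m
    rw [MvPolynomial.coeff_coe, MvPowerSeries.coeff_truncTotal_eq_ite]
    split_ifs with h
    · rfl
    · exact coeff_multiGenFun_mul_eq_zero hr m (not_lt.mp h)
  refine ⟨MvPowerSeries.truncTotal W F, hQ, ?_,
    (natDegree_specialise_le _).trans_lt (MvPowerSeries.totalDegree_truncTotal_lt F hW0)⟩
  rw [coe_specialise, ← hQ, hF, MvPowerSeries.subst_mul (hasSubst_const_X r), subst_multiGenFun,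
    ← coe_specialise, specialise_multiDenom]

/-! ### Asymptotics of weighted solution counts -/

/-- The number of solutions in natural numbers of `∑ i, u i * a i = n`. -/
noncomputable def solutionCount {r : ℕ} (u : Fin r → ℕ) (n : ℕ) : ℕ :=
  {a : Fin r → ℕ | ∑ i, u i * a i = n}.ncard

theorem finite_solutions {u : Fin r → ℕ} (hu : ∀ i, 0 < u i) (n : ℕ) :
    {a : Fin r → ℕ | ∑ i, u i * a i = n}.Finite := by
  refine (Set.finite_Iic fun _ : Fin r => n).subset fun a ha i => ?_
  have h1 : u i * a i ≤ ∑ i, u i * a i :=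
    Finset.single_le_sum (f := fun i => u i * a i) (fun _ _ => Nat.zero_le _) (Finset.mem_univ i)
  have h2 : a i ≤ u i * a i := Nat.le_mul_of_pos_left _ (hu i)
  have ha' : ∑ i, u i * a i = n := ha
  exact (h2.trans h1).trans ha'.le

theorem solutionCount_one (k n : ℕ) :
    solutionCount (fun _ : Fin (k + 1) => 1) n = (n + k).choose k := by
  have h : solutionCount (fun _ : Fin (k + 1) => 1) n =
      ((Finset.univ : Finset (Fin (k + 1))).finsuppAntidiag n : Set (Fin (k + 1) →₀ ℕ)).ncard := by
    refine Set.ncard_congr (fun a _ => Finsupp.equivFunOnFinite.symm a) ?_ ?_ ?_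
    · intro a ha
      simpa [Finset.mem_finsuppAntidiag] using ha
    · intro a b _ _ h
      exact Finsupp.equivFunOnFinite.symm.injective h
    · intro b hb
      refine ⟨b, ?_, by simp⟩
      simpa [Finset.mem_finsuppAntidiag] using hb
  rw [h, Set.ncard_coe_finset, Finset.card_finsuppAntidiag_nat_eq_choose, Finset.card_univ,
    Fintype.card_fin, show k + 1 + n - 1 = n + k by omega, Nat.choose_symm_add]

theorem ncard_solutions_prod {u : Fin r → ℕ} (n : ℕ) :
    ({a : Fin r → ℕ | ∑ i, u i * a i = n} ×ˢ
      (Fintype.piFinset fun i => Finset.range (u i) : Set (Fin r → ℕ))).ncard =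
      (∏ i, u i) * solutionCount u n := by
  rw [Set.ncard_prod, Set.ncard_coe_finset, Fintype.card_piFinset, mul_comm]
  simp [solutionCount]

theorem sum_mul_update {k : ℕ} {u : Fin (k + 1) → ℕ} (h0 : u 0 = 1) (a : Fin (k + 1) → ℕ) (c : ℕ) :
    ∑ i, u i * Function.update a 0 c i + a 0 = ∑ i, u i * a i + c := by
  rw [Fin.sum_univ_succ, Fin.sum_univ_succ, Function.update_self, h0]
  simp only [Function.update_of_ne (Fin.succ_ne_zero _)]
  ring

/-- Divide each `b i` by `u i` with remainder. Moving the sum of the remainders into coordinate `0`,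
where `u 0 = 1`, restores the total `n`; the remainders are kept, so the map is injective. -/
theorem choose_le_mul_solutionCount {k : ℕ} {u : Fin (k + 1) → ℕ} (hu : ∀ i, 0 < u i)
    (h0 : u 0 = 1) (n : ℕ) : (n + k).choose k ≤ (∏ i, u i) * solutionCount u n := by
  rw [← solutionCount_one, ← ncard_solutions_prod]
  refine Set.ncard_le_ncard_of_injOn (fun b => (Function.update (fun i => b i / u i) 0
    (b 0 + ∑ i, b i % u i), fun i => b i % u i)) ?_ ?_
    ((finite_solutions hu n).prod (Finset.finite_toSet _))
  · intro b hb
    have hb' : ∑ i, b i = n := by simpa using hb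
    refine ⟨?_, ?_⟩
    · have h1 := sum_mul_update h0 (fun i => b i / u i) (b 0 + ∑ i, b i % u i)
      have h2 : ∑ i, u i * (b i / u i) + ∑ i, b i % u i = n := by
        rw [← Finset.sum_add_distrib, ← hb']
        exact Finset.sum_congr rfl fun i _ => Nat.div_add_mod _ _
      simp only [h0, Nat.div_one] at h1
      change ∑ i, u i * Function.update (fun i => b i / u i) 0 (b 0 + ∑ i, b i % u i) i = n
      omega
    · simp only [Finset.mem_coe, Fintype.mem_piFinset, Finset.mem_range]
      exact fun i => Nat.mod_lt _ (hu i)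
  · intro b _ c _ h
    obtain ⟨h1, h2⟩ := Prod.mk.inj h
    funext i
    have h3 := congrFun h1 i
    have h4 := congrFun h2
    rcases eq_or_ne i 0 with rfl | hi
    · simp only [Function.update_self, Finset.sum_congr rfl fun i _ => h4 i] at h3
      exact Nat.add_right_cancel h3
    · simp only [Function.update_of_ne hi] at h3
      rw [← Nat.div_add_mod (b i) (u i), h3, h4 i, Nat.div_add_mod]

/-- Recombine quotients and remainders as `u i * a i + s i`, padding coordinate `0` up to the
largest possible remainder sum so that the total no longer depends on `s`. Nothing is lost there, as
`u 0 = 1` forces `s 0 = 0`. -/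
theorem mul_solutionCount_le_choose {k : ℕ} {u : Fin (k + 1) → ℕ} (hu : ∀ i, 0 < u i)
    (h0 : u 0 = 1) (n : ℕ) :
    (∏ i, u i) * solutionCount u n ≤ (n + (∑ i, (u i - 1)) + k).choose k := by
  rw [← solutionCount_one, ← ncard_solutions_prod]
  have hle : ∀ s ∈ Fintype.piFinset fun i => Finset.range (u i), ∑ i, s i ≤ ∑ i, (u i - 1) :=
    fun s hs => Finset.sum_le_sum fun i _ => by
      have := Finset.mem_range.mp (Fintype.mem_piFinset.mp hs i)
      omega
  have hs0 : ∀ s ∈ Fintype.piFinset fun i => Finset.range (u i), s 0 = 0 := fun s hs => by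
    have := Finset.mem_range.mp (Fintype.mem_piFinset.mp hs 0)
    omega
  refine Set.ncard_le_ncard_of_injOn (fun x => Function.update (fun i => u i * x.1 i + x.2 i) 0
    (x.1 0 + ((∑ i, (u i - 1)) - ∑ i, x.2 i))) ?_ ?_ (finite_solutions (fun _ => one_pos) _)
  · rintro ⟨a, s⟩ ⟨ha, hs⟩
    have ha' : ∑ i, u i * a i = n := ha
    have h1 := sum_mul_update (u := fun _ => 1) rfl (fun i => u i * a i + s i)
      (a 0 + ((∑ i, (u i - 1)) - ∑ i, s i))
    have h2 := hle s hs
    have h3 := hs0 s hs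
    simp only [one_mul, Finset.sum_add_distrib, h0, h3, ha'] at h1
    change ∑ i, 1 * _ = n + _
    simp only [one_mul]
    omega
  · rintro ⟨a, s⟩ ⟨-, hs⟩ ⟨b, t⟩ ⟨-, ht⟩ h
    have hpair : ∀ i, i ≠ 0 → a i = b i ∧ s i = t i := fun i hi => by
      have h1 := congrFun h i
      simp only [Function.update_of_ne hi] at h1
      have hsi := Finset.mem_range.mp (Fintype.mem_piFinset.mp hs i)
      have hti := Finset.mem_range.mp (Fintype.mem_piFinset.mp ht i)
      have h2 := congrArg (· % u i) h1
      simp only [Nat.mul_add_mod, Nat.mod_eq_of_lt hsi, Nat.mod_eq_of_lt hti] at h2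
      refine ⟨?_, h2⟩
      rw [h2] at h1
      exact Nat.eq_of_mul_eq_mul_left (hu i) (Nat.add_right_cancel h1)
    have hst : s = t := funext fun i => by
      rcases eq_or_ne i 0 with rfl | hi
      · rw [hs0 s hs, hs0 t ht]
      · exact (hpair i hi).2
    refine Prod.ext (funext fun i => ?_) hst
    rcases eq_or_ne i 0 with rfl | hi
    · have h1 := congrFun h 0
      simp only [Function.update_self, hst] at h1
      exact Nat.add_right_cancel h1
    · exact (hpair i hi).1

theorem tendsto_comp_add_div_pow {f : ℕ → ℝ} {c : ℝ} {k : ℕ}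
    (h : Tendsto (fun n : ℕ => f n / (n : ℝ) ^ k) atTop (𝓝 c)) (a : ℕ) :
    Tendsto (fun n : ℕ => f (n + a) / (n : ℝ) ^ k) atTop (𝓝 c) := by
  have h1 : Tendsto (fun n : ℕ => (((n + a : ℕ) : ℝ) / n) ^ k) atTop (𝓝 1) := by
    have h2 : Tendsto (fun n : ℕ => (1 + (a : ℝ) / n) ^ k) atTop (𝓝 ((1 + 0) ^ k)) :=
      (tendsto_const_nhds.add (tendsto_const_div_atTop_nhds_zero_nat (a : ℝ))).pow k
    rw [add_zero, one_pow] at h2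
    refine h2.congr' ?_
    filter_upwards [eventually_gt_atTop 0] with n hn
    have : (n : ℝ) ≠ 0 := by positivity
    push_cast
    field_simp
  have h3 := (h.comp (tendsto_add_atTop_nat a)).mul h1
  rw [mul_one] at h3
  refine h3.congr' ?_
  filter_upwards [eventually_gt_atTop 0] with n hn
  have h4 : (n : ℝ) ≠ 0 := by positivity
  have h5 : ((n + a : ℕ) : ℝ) ≠ 0 := by positivity
  simp only [Function.comp]
  rw [div_pow, div_mul_div_cancel₀ (pow_ne_zero k h5)]

theorem tendsto_comp_sub_div_pow {f : ℕ → ℝ} {c : ℝ} {k : ℕ}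
    (h : Tendsto (fun n : ℕ => f n / (n : ℝ) ^ k) atTop (𝓝 c)) (a : ℕ) :
    Tendsto (fun n : ℕ => f (n - a) / (n : ℝ) ^ k) atTop (𝓝 c) := by
  have h1 : Tendsto (fun n : ℕ => ((n : ℝ) / ((n + a : ℕ) : ℝ)) ^ k) atTop (𝓝 1) := by
    have h2 := tendsto_comp_add_div_pow (f := fun n => (n : ℝ) ^ k) (c := 1) (k := k)
      (tendsto_const_nhds.congr' (by
        filter_upwards [eventually_gt_atTop 0] with n hn
        have : (n : ℝ) ≠ 0 := by positivity
        field_simp)) a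
    have h3 := h2.inv₀ one_ne_zero
    rw [inv_one] at h3
    exact h3.congr fun n => by rw [← div_pow, ← inv_pow, inv_div]
  rw [← tendsto_add_atTop_iff_nat a]
  have h3 := h.mul h1
  rw [mul_one] at h3
  refine h3.congr' ?_
  filter_upwards [eventually_gt_atTop 0] with n hn
  have h4 : (n : ℝ) ≠ 0 := by positivity
  rw [div_pow, div_mul_div_cancel₀ (pow_ne_zero k h4), Nat.add_sub_cancel]

theorem tendsto_choose_div_pow (k a : ℕ) :
    Tendsto (fun n : ℕ => (((n + a).choose k : ℕ) : ℝ) / (n : ℝ) ^ k) atTop (𝓝 (1 / k !)) := by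
  refine tendsto_comp_add_div_pow (f := fun n => ((n.choose k : ℕ) : ℝ)) ?_ a
  refine ((isEquivalent_choose k).div Asymptotics.IsEquivalent.refl).symm.tendsto_nhds
    (tendsto_const_nhds.congr' ?_)
  filter_upwards [eventually_gt_atTop 0] with n hn
  have : (n : ℝ) ≠ 0 := by positivity
  simp only [Pi.div_apply]
  field_simp

theorem tendsto_solutionCount {k : ℕ} {u : Fin (k + 1) → ℕ} (hu : ∀ i, 0 < u i) (h0 : u 0 = 1) :
    Tendsto (fun n : ℕ => (solutionCount u n : ℝ) / (n : ℝ) ^ k) atTop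
      (𝓝 (1 / k ! / ∏ i, (u i : ℝ))) := by
  have hP : (0 : ℝ) < ∏ i, (u i : ℝ) := Finset.prod_pos fun i _ => by exact_mod_cast hu i
  refine tendsto_of_tendsto_of_tendsto_of_le_of_le
    ((tendsto_choose_div_pow k k).div_const _)
    ((tendsto_choose_div_pow k ((∑ i, (u i - 1)) + k)).div_const _) (fun n => ?_) fun n => ?_
  · have h : (((n + k).choose k : ℕ) : ℝ) ≤ (∏ i, (u i : ℝ)) * solutionCount u n := by
      exact_mod_cast choose_le_mul_solutionCount hu h0 n
    simp only
    rw [div_right_comm]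
    gcongr
    rwa [div_le_iff₀' hP]
  · have h : (∏ i, (u i : ℝ)) * solutionCount u n ≤
        (((n + ((∑ i, (u i - 1)) + k)).choose k : ℕ) : ℝ) := by
      rw [← add_assoc]
      exact_mod_cast mul_solutionCount_le_choose hu h0 n
    simp only
    rw [div_right_comm]
    gcongr
    rwa [le_div_iff₀' hP]

theorem mk_dvd_mul_one_sub_X_pow {u : ℕ} (hu : 0 < u) :
    (PowerSeries.mk fun n => if u ∣ n then (1 : ℤ) else 0) * (1 - PowerSeries.X ^ u) = 1 := by
  ext n
  rw [mul_sub, mul_one, map_sub, PowerSeries.coeff_mul_X_pow', PowerSeries.coeff_mk,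
    PowerSeries.coeff_one]
  rcases lt_or_ge n u with h | h
  · rw [if_neg (not_le.mpr h), sub_zero]
    refine if_congr ⟨fun hd => Nat.eq_zero_of_dvd_of_lt hd h, ?_⟩ rfl rfl
    rintro rfl
    exact dvd_zero u
  · rw [if_pos h, PowerSeries.coeff_mk, if_neg (show n ≠ 0 by omega)]
    simp only [(Nat.dvd_sub_iff_left h dvd_rfl), sub_self]

theorem mk_solutionCount_mul_prod {u : Fin r → ℕ} (hu : ∀ i, 0 < u i) :
    (PowerSeries.mk fun n => (solutionCount u n : ℤ)) * ∏ i, (1 - PowerSeries.X ^ u i) = 1 := by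
  have h : (PowerSeries.mk fun n => (solutionCount u n : ℤ)) =
      ∏ i, PowerSeries.mk fun n => if u i ∣ n then (1 : ℤ) else 0 := by
    ext n
    rw [PowerSeries.coeff_mk, PowerSeries.coeff_prod]
    simp only [PowerSeries.coeff_mk, Finset.prod_ite_zero, Finset.prod_const_one, Finset.mem_univ,
      true_imp_iff]
    rw [Finset.sum_boole, Nat.cast_inj, ← Set.ncard_coe_finset]
    refine Set.ncard_congr (fun a _ => Finsupp.equivFunOnFinite.symm fun i => u i * a i) ?_ ?_ ?_
    · intro a ha
      have ha' : ∑ i, u i * a i = n := ha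
      simp [Finset.mem_finsuppAntidiag, ha']
    · intro a b _ _ h
      have h' := Finsupp.equivFunOnFinite.symm.injective h
      exact funext fun i => Nat.eq_of_mul_eq_mul_left (hu i) (congrFun h' i)
    · intro b hb
      simp only [Finset.coe_filter, Finset.mem_finsuppAntidiag, Set.mem_ofPred_eq] at hb
      obtain ⟨⟨hb, -⟩, hd⟩ := hb
      refine ⟨fun i => b i / u i, ?_, ?_⟩
      · change ∑ i, u i * (b i / u i) = n
        rw [← hb]
        exact Finset.sum_congr rfl fun i _ => Nat.mul_div_cancel' (hd i)
      · ext i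
        simp [Nat.mul_div_cancel' (hd i)]
  rw [h, ← Finset.prod_mul_distrib]
  exact Finset.prod_eq_one fun i _ => mk_dvd_mul_one_sub_X_pow (hu i)

/-! ### First and second differences of partitions -/

/-- Two sequences with the same differences and the same tail are equal. -/
theorem eq_of_recurrence {f g c : ℕ → ℕ} (hf0 : ∀ x, r ≤ x → f x = 0) (hg0 : ∀ x, r ≤ x → g x = 0)
    (hf : ∀ x < r, f x = f (x + 1) + c x) (hg : ∀ x < r, g x = g (x + 1) + c x) : f = g := by
  have key : ∀ d x, r ≤ x + d → f x = g x := by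
    intro d
    induction d with
    | zero => exact fun x hx => by rw [hf0 x hx, hg0 x hx]
    | succ d ih =>
      intro x hx
      rcases lt_or_ge x r with h | h
      · rw [hf x h, hg x h, ih (x + 1) (by omega)]
      · rw [hf0 x h, hg0 x h]
  exact funext fun x => key r x (by omega)

/-- The sequence with differences `a`. -/
def stepSum (a : Fin r → ℕ) (x : ℕ) : ℕ := ∑ i : Fin r, if x ≤ i then a i else 0

/-- The sequence with second differences `a`. -/
def rampSum (a : Fin r → ℕ) (x : ℕ) : ℕ := ∑ i : Fin r, ((i : ℕ) + 1 - x) * a i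

theorem stepSum_of_ge (a : Fin r → ℕ) {x : ℕ} (hx : r ≤ x) : stepSum a x = 0 :=
  Finset.sum_eq_zero fun i _ => if_neg (by omega)

theorem rampSum_of_ge (a : Fin r → ℕ) {x : ℕ} (hx : r ≤ x) : rampSum a x = 0 :=
  Finset.sum_eq_zero fun i _ => by rw [Nat.sub_eq_zero_of_le (by omega), zero_mul]

theorem stepSum_eq (a : Fin r → ℕ) (i : Fin r) : stepSum a i = stepSum a (i + 1) + a i := by
  have h : a i = ∑ j : Fin r, if i = j then a j else 0 := by simp
  rw [stepSum, stepSum, h, ← Finset.sum_add_distrib]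
  refine Finset.sum_congr rfl fun j _ => ?_
  simp only [Fin.ext_iff]
  split_ifs <;> omega

theorem rampSum_eq (a : Fin r → ℕ) (x : ℕ) : rampSum a x = rampSum a (x + 1) + stepSum a x := by
  rw [stepSum, rampSum, rampSum, ← Finset.sum_add_distrib]
  refine Finset.sum_congr rfl fun j _ => ?_
  split_ifs with h
  · rw [show (j : ℕ) + 1 - x = ((j : ℕ) + 1 - (x + 1)) + 1 by omega]
    ring
  · rw [Nat.sub_eq_zero_of_le (by omega), Nat.sub_eq_zero_of_le (by omega), zero_mul, add_zero]

theorem stepSum_sub {f : ℕ → ℕ} (hf : ∀ x < r, f (x + 1) ≤ f x) (hf0 : ∀ x, r ≤ x → f x = 0) :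
    stepSum (fun i : Fin r => f i - f (i + 1)) = f :=
  eq_of_recurrence (c := fun x => f x - f (x + 1)) (fun x hx => stepSum_of_ge _ hx) hf0
    (fun x hx => stepSum_eq _ ⟨x, hx⟩) fun x hx => by have := hf x hx; omega

theorem rampSum_sub {f : ℕ → ℕ} (hf : ∀ x < r, 2 * f (x + 1) ≤ f x + f (x + 2))
    (hanti : ∀ x, f (x + 1) ≤ f x) (hf0 : ∀ x, r ≤ x → f x = 0) :
    rampSum (fun i : Fin r => f i + f (i + 2) - 2 * f (i + 1)) = f := by
  have h : stepSum (fun i : Fin r => f i + f (i + 2) - 2 * f (i + 1)) = fun x => f x - f (x + 1) := by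
    rw [← stepSum_sub (r := r) (f := fun x => f x - f (x + 1)) (fun x hx => by
      have h1 := hf x hx
      have h2 := hanti (x + 1)
      simp only [add_assoc, Nat.reduceAdd] at h2 ⊢
      omega) fun x hx => by rw [hf0 x hx, Nat.zero_sub]]
    congr 1
    funext i
    have h1 := hf i i.2
    have h2 := hanti (i + 1)
    simp only [add_assoc, Nat.reduceAdd] at h2 ⊢
    omega
  refine eq_of_recurrence (c := fun x => f x - f (x + 1)) (fun x hx => rampSum_of_ge _ hx) hf0
    (fun x hx => ?_) fun x hx => ?_
  · rw [rampSum_eq, h]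
  · have := hanti x
    omega

theorem sum_stepSum (a : Fin r → ℕ) :
    ∑ x ∈ Finset.range r, stepSum a x = ∑ i : Fin r, ((i : ℕ) + 1) * a i := by
  unfold stepSum
  rw [Finset.sum_comm]
  refine Finset.sum_congr rfl fun i _ => ?_
  rw [← Finset.sum_filter, Finset.sum_const, smul_eq_mul]
  congr 1
  rw [← Finset.card_range ((i : ℕ) + 1)]
  congr 1
  ext x
  simp only [Finset.mem_filter, Finset.mem_range]
  omega

theorem sum_rampSum (a : Fin r → ℕ) :
    ∑ x ∈ Finset.range r, rampSum a x = ∑ i : Fin r, ((i : ℕ) + 1) * (i + 2) / 2 * a i := by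
  unfold rampSum
  rw [Finset.sum_comm]
  refine Finset.sum_congr rfl fun i _ => ?_
  rw [← Finset.sum_mul, sum_ramp i.2]

theorem antitone_stepSum (a : Fin r → ℕ) : Antitone (stepSum a) := fun x y hxy =>
  Finset.sum_le_sum fun i _ => by split_ifs <;> omega

theorem antitone_rampSum (a : Fin r → ℕ) : Antitone (rampSum a) := fun x y hxy =>
  Finset.sum_le_sum fun i _ => Nat.mul_le_mul_right _ (by omega)

/-- Each ramp is the maximum of an affine function and zero, hence convex, and the coefficients `a`
are non-negative. -/
theorem rampSum_convex (a : Fin r → ℕ) {i m k : ℕ} (him : i < m) (hmk : m < k) :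
    ((k : ℤ) - i) * rampSum a m ≤ ((k : ℤ) - m) * rampSum a i + ((m : ℤ) - i) * rampSum a k := by
  have him' : (i : ℤ) < m := by exact_mod_cast him
  have hmk' : (m : ℤ) < k := by exact_mod_cast hmk
  simp only [rampSum, Nat.cast_sum, Finset.mul_sum, ← Finset.sum_add_distrib]
  refine Finset.sum_le_sum fun j _ => ?_
  push_cast
  simp only [← mul_assoc, ← add_mul]
  refine mul_le_mul_of_nonneg_right ?_ (Int.natCast_nonneg _)
  rcases le_or_gt m ((j : ℕ) + 1) with h | h
  · have h1 : ((((j : ℕ) + 1 - k : ℕ)) : ℤ) ≥ j + 1 - k := by omega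
    have h2 := mul_le_mul_of_nonneg_left h1 (show (0 : ℤ) ≤ m - i by linarith)
    push_cast [Nat.cast_sub h, Nat.cast_sub (him.le.trans h)]
    linarith
  · rw [Nat.sub_eq_zero_of_le h.le]
    simp only [Nat.cast_zero, mul_zero]
    exact add_nonneg (mul_nonneg (by linarith) (Int.natCast_nonneg _))
      (mul_nonneg (by linarith) (Int.natCast_nonneg _))

theorem hits_rampSum (a : Fin r → ℕ) : Hits r ∅ fun x => (rampSum a x : ℤ) := by
  rw [hits_empty_iff]
  rintro i k ⟨m, him, ⟨hmk, -, h⟩ | ⟨-, -, h⟩⟩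
  · have h1 := rampSum_convex a him hmk
    have h2 : (i : ℤ) < k := by exact_mod_cast him.trans hmk
    simp only [mul_sub] at h
    linarith
  · have := antitone_rampSum a him.le
    exact absurd this (not_le.mpr (Int.ofNat_lt.mp h))

theorem numPartitions_eq (n r : ℕ) :
    numPartitions n r = solutionCount (fun i : Fin r => (i : ℕ) + 1) n := by
  have hinv : ∀ p : IntPartition, p.numParts ≤ r →
      stepSum (fun i : Fin r => p.seq i - p.seq (i + 1)) = p.seq := fun p hp =>
    stepSum_sub (fun x _ => p.antitone (Nat.le_succ x)) (IntPartition.numParts_le_iff.mp hp)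
  refine Set.ncard_congr (fun p _ i => p.seq i - p.seq (i + 1)) ?_ ?_ ?_
  · rintro p ⟨hw, hp⟩
    change ∑ i : Fin r, ((i : ℕ) + 1) * (p.seq i - p.seq (i + 1)) = n
    rw [← sum_stepSum, hinv p hp, ← IntPartition.weight_eq_sum_range hp, hw]
  · rintro p q ⟨-, hp⟩ ⟨-, hq⟩ h
    refine IntPartition.ext (DFunLike.coe_injective ?_)
    rw [← hinv p hp, ← hinv q hq]
    exact congrArg stepSum h
  · intro a ha
    obtain ⟨p, hp, hseq⟩ := exists_intPartition (antitone_stepSum a) fun x hx => stepSum_of_ge a hx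
    refine ⟨p, ⟨?_, hp⟩, funext fun i => ?_⟩
    · rw [IntPartition.weight_eq_sum_range hp, ← show ∑ i : Fin r, ((i : ℕ) + 1) * a i = n from ha,
        ← sum_stepSum]
      exact Finset.sum_congr rfl fun x _ => hseq x
    · rw [hseq, hseq, stepSum_eq, Nat.add_sub_cancel_left]

/-- The weight `(i + 1)(i + 2) / 2` of the `i`-th ramp. -/
def triangle (r : ℕ) (i : Fin r) : ℕ := ((i : ℕ) + 1) * (i + 2) / 2

theorem triangle_pos (i : Fin r) : 0 < triangle r i :=
  Nat.div_pos (by nlinarith [Nat.zero_le (i : ℕ)]) two_pos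

theorem triangle_zero (k : ℕ) : triangle (k + 1) 0 = 1 := by simp [triangle]

/-- Genuinely convex sequences, those with non-negative second differences, are concave partitions.
The second differences recover `a`. -/
theorem solutionCount_le_numConcave (n r : ℕ) :
    solutionCount (triangle r) n ≤ numConcave n r := by
  refine (Set.ncard_le_ncard (t := (fun (p : IntPartition) (i : Fin r) =>
    p.seq i + p.seq (i + 2) - 2 * p.seq (i + 1)) '' concavePartitions n r) ?_
    ((finite_concavePartitions n r).image _)).trans
    (Set.ncard_image_le (finite_concavePartitions n r))
  intro a ha
  obtain ⟨p, hp, hseq⟩ := exists_intPartition (antitone_rampSum a) fun x hx => rampSum_of_ge a hx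
  refine ⟨p, ⟨⟨?_, hp⟩, ?_⟩, funext fun i => ?_⟩
  · rw [IntPartition.weight_eq_sum_range hp, ← show ∑ i, triangle r i * a i = n from ha]
    simp only [triangle]
    rw [← sum_rampSum]
    exact Finset.sum_congr rfl fun x _ => hseq x
  · rw [isConcave_iff_hits hp]
    simp only [hseq]
    exact hits_rampSum a
  · have h1 := rampSum_eq a i
    have h2 := rampSum_eq a (i + 1)
    have h3 := stepSum_eq a i
    simp only [add_assoc, Nat.reduceAdd] at h2
    simp only [hseq]
    omega

/-- Second differences of a concave partition are at least `-1`, so adding every ramp once makes it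
convex and raises the weight by `∑ i, triangle r i`. -/
theorem numConcave_le_solutionCount (n r : ℕ) :
    numConcave n r ≤ solutionCount (triangle r) (n + ∑ i, triangle r i) := by
  have hinv : ∀ p ∈ concavePartitions n r,
      rampSum (fun i : Fin r => p.seq i + p.seq (i + 2) + 1 - 2 * p.seq (i + 1)) =
        fun x => p.seq x + rampSum (fun _ : Fin r => 1) x := by
    rintro p ⟨⟨hw, hp⟩, hc⟩
    have h0 := IntPartition.numParts_le_iff.mp hp
    have hstep := fun i : Fin r => stepSum_eq (fun _ : Fin r => 1) i
    have hramp := rampSum_eq (fun _ : Fin r => 1)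
    have hconv : ∀ x < r, 2 * p.seq (x + 1) ≤ p.seq x + p.seq (x + 2) + 1 := by
      intro x hx
      by_contra hcon
      -- Non-violation of `(x, x + 2)` at its midpoint reads `2λ_{x+1} - 2 < λ_x + λ_{x+2}`; past
      -- the last part the midpoint is zero.
      rcases Nat.lt_or_ge (x + 1) r with hx1 | hx1
      · refine hits_empty_iff.mp ((isConcave_iff_hits hp).mp hc) x (x + 2)
          ⟨x + 1, by omega, Or.inl ⟨by omega, by omega, ?_⟩⟩
        push_cast
        ring_nf
        ring_nf at hcon
        omega
      · have := h0 (x + 1) hx1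
        omega
    rw [← rampSum_sub (r := r) (f := fun x => p.seq x + rampSum (fun _ : Fin r => 1) x)
      (fun x hx => ?_) (fun x => ?_) fun x hx => ?_]
    · congr 1
      funext i
      have h1 := hstep i
      have h2 := hramp i
      have h3 := hramp (i + 1)
      simp only [add_assoc, Nat.reduceAdd] at h3
      omega
    · have h1 := hstep ⟨x, hx⟩
      have h2 := hramp x
      have h3 := hramp (x + 1)
      have h4 := hconv x hx
      simp only [add_assoc, Nat.reduceAdd] at h1 h3 ⊢
      omega
    · exact Nat.add_le_add (p.antitone (Nat.le_succ x)) (antitone_rampSum _ (Nat.le_succ x))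
    · rw [h0 x hx, rampSum_of_ge _ hx]
  refine Set.ncard_le_ncard_of_injOn (fun (p : IntPartition) (i : Fin r) =>
    p.seq i + p.seq (i + 2) + 1 - 2 * p.seq (i + 1)) ?_ ?_ (finite_solutions triangle_pos _)
  · intro p hp
    change ∑ i : Fin r, triangle r i * (p.seq i + p.seq (i + 2) + 1 - 2 * p.seq (i + 1)) = _
    have h1 : ∑ i : Fin r, triangle r i = ∑ x ∈ Finset.range r, rampSum (fun _ : Fin r => 1) x := by
      rw [sum_rampSum]
      simp [triangle]
    simp only [h1]
    unfold triangle
    rw [← sum_rampSum, hinv p hp, Finset.sum_add_distrib,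
      ← IntPartition.weight_eq_sum_range hp.1.2, hp.1.1]
  · intro p hp q hq h
    have h1 := (hinv p hp).symm.trans ((congrArg rampSum h).trans (hinv q hq))
    exact IntPartition.ext (Finsupp.ext fun x => Nat.add_right_cancel (congrFun h1 x))

/-! ### Limits and the value at one -/

theorem tendsto_numPartitions (k : ℕ) :
    Tendsto (fun n : ℕ => (numPartitions n (k + 1) : ℝ) / (n : ℝ) ^ k) atTop
      (𝓝 (1 / k ! / ((k + 1)! : ℝ))) := by
  have h := tendsto_solutionCount (u := fun i : Fin (k + 1) => (i : ℕ) + 1)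
    (fun i => Nat.succ_pos _) rfl
  have hprod : ∏ i : Fin (k + 1), (((i : ℕ) + 1 : ℕ) : ℝ) = ((k + 1)! : ℝ) := by
    rw [← Finset.prod_range_add_one_eq_factorial, Nat.cast_prod, Finset.prod_range]
  rw [hprod] at h
  simpa only [numPartitions_eq] using h

theorem tendsto_numConcave (k : ℕ) :
    Tendsto (fun n : ℕ => (numConcave n (k + 1) : ℝ) / (n : ℝ) ^ k) atTop
      (𝓝 (1 / k ! / ∏ i, (triangle (k + 1) i : ℝ))) := by
  have h := tendsto_solutionCount (u := triangle (k + 1)) triangle_pos (triangle_zero k)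
  refine tendsto_of_tendsto_of_tendsto_of_le_of_le h
    (tendsto_comp_add_div_pow h (∑ i, triangle (k + 1) i)) (fun n => ?_) fun n => ?_
  · simp only
    gcongr
    exact solutionCount_le_numConcave n _
  · simp only
    gcongr
    exact numConcave_le_solutionCount n _

theorem denom_eq_prod (r : ℕ) :
    (denom r : PowerSeries ℤ) = ∏ i, (1 - PowerSeries.X ^ triangle r i) := by
  rw [denom, show Finset.Icc 1 r = Finset.Ico 1 (r + 1) by ext; simp,
    Finset.prod_Ico_eq_prod_range, Nat.add_sub_cancel, Finset.prod_range,
    ← Polynomial.coeToPowerSeries.ringHom_apply, map_prod]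
  refine Finset.prod_congr rfl fun i _ => ?_
  rw [map_sub, map_one, map_pow, Polynomial.coeToPowerSeries.ringHom_apply, Polynomial.coe_X,
    triangle]
  congr 3
  ring

/-- The coefficients of `P / denom` grow like `P(1) c n^k`, since the finitely many shifts do not
affect the leading term; the concave counts grow like `c n^k` with the same `c ≠ 0`. -/
theorem eval_one_of_genFun_mul_denom {k : ℕ} {P : Polynomial ℤ}
    (h : genFun (k + 1) * (denom (k + 1) : PowerSeries ℤ) = (P : PowerSeries ℤ)) :
    P.eval 1 = 1 := by
  set D : PowerSeries ℤ := PowerSeries.mk fun n => (solutionCount (triangle (k + 1)) n : ℤ) with hD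
  set c : ℝ := 1 / k ! / ∏ i, (triangle (k + 1) i : ℝ) with hc
  have hc0 : c ≠ 0 := by
    have hP : (0 : ℝ) < ∏ i, (triangle (k + 1) i : ℝ) :=
      Finset.prod_pos fun i _ => by exact_mod_cast triangle_pos i
    have hk : (0 : ℝ) < k ! := by exact_mod_cast k.factorial_pos
    positivity
  have hgen : genFun (k + 1) = P * D := by
    rw [← h, mul_assoc, mul_comm _ D, hD, denom_eq_prod, mk_solutionCount_mul_prod triangle_pos,
      mul_one]
  -- For `n ≥ deg P` no `n - j` is truncated, and the convolution has a fixed number of terms.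
  have hcoeff : ∀ n, P.natDegree ≤ n → (numConcave n (k + 1) : ℝ) =
      ∑ j ∈ Finset.range (P.natDegree + 1),
        (P.coeff j : ℝ) * (solutionCount (triangle (k + 1)) (n - j) : ℝ) := by
    intro n hn
    have h1 := congrArg (PowerSeries.coeff n) hgen
    rw [genFun, PowerSeries.coeff_mk, PowerSeries.coeff_mul,
      Finset.Nat.sum_antidiagonal_eq_sum_range_succ
        (fun i j => PowerSeries.coeff i (P : PowerSeries ℤ) * PowerSeries.coeff j D) n,
      ← Finset.sum_subset (Finset.range_mono (Nat.succ_le_succ hn)) fun j _ hj => by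
        rw [Polynomial.coeff_coe, Polynomial.coeff_eq_zero_of_natDegree_lt
          (by simpa [Nat.lt_succ_iff] using hj), zero_mul]] at h1
    simp only [Polynomial.coeff_coe, hD, PowerSeries.coeff_mk] at h1
    exact_mod_cast congrArg (Int.cast : ℤ → ℝ) h1
  have hlim : Tendsto (fun n : ℕ => (numConcave n (k + 1) : ℝ) / (n : ℝ) ^ k) atTop
      (𝓝 (∑ j ∈ Finset.range (P.natDegree + 1), (P.coeff j : ℝ) * c)) := by
    refine (tendsto_finsetSum _ fun j _ => (tendsto_comp_sub_div_pow (tendsto_solutionCount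
      (u := triangle (k + 1)) triangle_pos (triangle_zero k)) j).const_mul (P.coeff j : ℝ)).congr' ?_
    filter_upwards [eventually_ge_atTop P.natDegree] with n hn
    rw [hcoeff n hn, Finset.sum_div]
    exact Finset.sum_congr rfl fun j _ => by rw [mul_div_assoc]
  have huniq := tendsto_nhds_unique hlim (tendsto_numConcave k)
  rw [← Finset.sum_mul] at huniq
  have h1 : ∑ j ∈ Finset.range (P.natDegree + 1), (P.coeff j : ℝ) = 1 :=
    mul_right_cancel₀ hc0 (huniq.trans (one_mul c).symm)
  rw [Polynomial.eval_eq_sum_range]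
  simp only [one_pow, mul_one]
  exact_mod_cast h1

theorem prod_triangle (r : ℕ) : ∏ i, (triangle r i : ℝ) =
    ∏ i ∈ Finset.Icc 1 r, ((i : ℝ) * ((i : ℝ) + 1) / 2) := by
  rw [show Finset.Icc 1 r = Finset.Ico 1 (r + 1) by ext; simp,
    Finset.prod_Ico_eq_prod_range, Nat.add_sub_cancel, Finset.prod_range]
  refine Finset.prod_congr rfl fun i _ => ?_
  rw [triangle, Nat.cast_div ((Nat.even_mul_succ_self (i + 1)).two_dvd) two_ne_zero]
  push_cast
  ring

theorem six_mul_sum_triangle (r : ℕ) :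
    6 * ∑ j ∈ Finset.range r, (j + 1) * (j + 2) / 2 = r * (r + 1) * (r + 2) := by
  induction r with
  | zero => simp
  | succ r ih =>
    rw [Finset.sum_range_succ, mul_add, ih]
    have h : 2 * ((r + 1) * (r + 2) / 2) = (r + 1) * (r + 2) :=
      Nat.mul_div_cancel' (Nat.even_mul_succ_self (r + 1)).two_dvd
    rw [show 6 * ((r + 1) * (r + 2) / 2) = 3 * (2 * ((r + 1) * (r + 2) / 2)) by ring, h]
    ring

end ConcavePartition

theorem mainTheorem2 (r : ℕ) (hr : 0 < r) :
    (∃ Q : MvPolynomial (Fin r) ℤ,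
      ConcavePartition.multiGenFun r * (ConcavePartition.multiDenom r : MvPowerSeries (Fin r) ℤ)
          = (Q : MvPowerSeries (Fin r) ℤ) ∧
      ConcavePartition.genFun r * (ConcavePartition.denom r : PowerSeries ℤ)
          = (ConcavePartition.specialise Q : PowerSeries ℤ) ∧
      (ConcavePartition.specialise Q).eval 1 = 1 ∧
      ((ConcavePartition.specialise Q).natDegree : ℝ)
          < (r : ℝ) ^ 3 / 6 + (r : ℝ) ^ 2 / 2 + (r : ℝ) / 3) ∧
    Tendsto
      (fun n : ℕ =>
        (ConcavePartition.numConcave n r : ℝ) / (ConcavePartition.numPartitions n r : ℝ))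
      atTop
      (𝓝 ((r ! : ℝ) / ∏ i ∈ Finset.Icc 1 r, ((i : ℝ) * ((i : ℝ) + 1) / 2))) := by
  obtain ⟨k, rfl⟩ := Nat.exists_eq_succ_of_ne_zero hr.ne'
  refine ⟨?_, ?_⟩
  · obtain ⟨Q, hQ, hspec, hdeg⟩ := ConcavePartition.exists_numerator hr
    refine ⟨Q, hQ, hspec, ConcavePartition.eval_one_of_genFun_mul_denom hspec, ?_⟩
    have h1 := ConcavePartition.six_mul_sum_triangle (k + 1)
    have h2 : ((6 * ∑ j ∈ Finset.range (k + 1), (j + 1) * (j + 2) / 2 : ℕ) : ℝ) =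
        (((k + 1) * (k + 1 + 1) * (k + 1 + 2) : ℕ) : ℝ) := congrArg Nat.cast h1
    have h3 : ((ConcavePartition.specialise Q).natDegree : ℝ) <
        ((∑ j ∈ Finset.range (k + 1), (j + 1) * (j + 2) / 2 : ℕ) : ℝ) := Nat.cast_lt.mpr hdeg
    rw [Nat.cast_mul] at h2
    push_cast at h2 h3 ⊢
    linarith
  · have hk : (k ! : ℝ) ≠ 0 := by exact_mod_cast k.factorial_ne_zero
    have hk1 : ((k + 1)! : ℝ) ≠ 0 := by exact_mod_cast (k + 1).factorial_ne_zero
    have h := (ConcavePartition.tendsto_numConcave k).div (ConcavePartition.tendsto_numPartitions k)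
      (by positivity)
    rw [ConcavePartition.prod_triangle, div_div_div_eq, mul_comm (1 / (k ! : ℝ)),
      mul_div_mul_right _ _ (by positivity)] at h
    refine h.congr' ?_
    filter_upwards [eventually_gt_atTop 0] with n hn
    have hn' : (n : ℝ) ^ k ≠ 0 := by positivity
    exact div_div_div_cancel_right₀ hn' _ _
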